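/- Let $\kappa$ be an uncountable cardinal with $\kappa^{<\kappa}=\kappa$, identified with the set of ordinals below it. For pairs of ordinals let $\langle\alpha_0,\beta_0\rangle\prec\langle\alpha_1,\beta_1\rangle$ mean that $\langle\max(\alpha_0,\beta_0),\alpha_0,\beta_0\rangle$ is lexicographically less than $\langle\max(\alpha_1,\beta_1),\alpha_1,\beta_1\rangle$. This is a well-order, and the Gödel pairing function $\mathfrak g$ is defined by: $\mathfrak g(\alpha,\beta)$ is the order type of the set of pairs that $\prec$-precede $\langle\alpha,\beta\rangle$. A type two $\kappa$-Turing machine has finitely many states (numbered by natural numbers, with initial state $0$), a read-only input tape, finitely many read-write scratch tapes and a write-only output tape. The tapes are of length $\kappa$, their cells contain $0$ or $1$ (by default $0$), and every head starts at cell $0$. The machine runs for $\kappa$ steps. At successor stages it acts like an ordinary Turing machine (a head that moves left from a cell with no immediate predecessor goes to cell $0$), and the output head writes and advances by one cell or does nothing. At limit stages the state and the content of each cell are the inferior limits of their earlier values, and the position of each head is the inferior limit of its positions at the earlier stages in which the machine was in the limit state. The machine computes a partial function $F:2^\kappa\to 2^\kappa$ if, on each input $x\in\operatorname{dom}(F)$,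 for every $\alpha<\kappa$ there is a stage $\beta<\kappa$ at which $F(x)\upharpoonright\alpha$ has been written on the output tape; $F$ is computable if some such machine computes it. Let $\delta_\kappa:2^\kappa\to\kappa$ be the partial function with $\delta_\kappa(p)=\alpha$ iff $p=0^\alpha1\mathbf 0$, where $\mathbf 0$ is the constant $0$ sequence of length $\kappa$. Represent $\kappa\times\kappa$ by the product representation: $r\in 2^\kappa$ is a name of $\langle\alpha,\beta\rangle$ iff the subsequence of $r$ at the even places $2\cdot\xi$ ($\xi<\kappa$) is the $\delta_\kappa$-name of $\alpha$, and the subsequence at the odd places $2\cdot\xi+1$ is the $\delta_\kappa$-name of $\beta$. A function between represented spaces is called $\delta_\kappa$-computable (with respect to these representations) if there is a computable partial $F:2^\kappa\to2^\kappa$ that maps each name of each point $x$ to a name of the value at $x$. Then the restriction of $\mathfrak g$ to $\kappa\times\kappa$ is a bijection from $\kappa\times\kappa$ onto $\kappa$, it is $\delta_\kappa$-computable, and its inverse $\kappa\to\kappa\times\kappa$ is $\delta_\kappa$-computable. -/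

import Mathlib

universe u v w

open Filter Set

/-! ### The Gödel pairing function -/

namespace Goedel

/-- `p ≺ q` for pairs of ordinals: `⟨max p₁ p₂, p₁, p₂⟩` is lexicographically less than
`⟨max q₁ q₂, q₁, q₂⟩`. -/
def Prec (p q : Ordinal.{u} × Ordinal.{u}) : Prop :=
  toLex (max p.1 p.2, toLex (p.1, p.2)) < toLex (max q.1 q.2, toLex (q.1, q.2))

instance instIsWellOrderPrec : IsWellOrder (Ordinal.{u} × Ordinal.{u}) Prec.{u} :=
  RelEmbedding.isWellOrder (s := (· < · : Ordinal ×ₗ Ordinal ×ₗ Ordinal → _ → Prop))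
    { toFun := fun p => toLex (max p.1 p.2, toLex (p.1, p.2))
      inj' := by
        intro p q h
        simpa [Prod.ext_iff] using congrArg (fun z => (ofLex (ofLex z).2)) h
      map_rel_iff' := Iff.rfl }

/-- The pairs that come before `p`. -/
abbrev Before (p : Ordinal.{u} × Ordinal.{u}) : Type (u + 1) := {q // Prec q p}

instance instSmallBefore (p : Ordinal.{u} × Ordinal.{u}) : Small.{u} (Before p) := by
  have key : ∀ q : Before p, max q.1.1 q.1.2 ≤ max p.1 p.2 := by
    intro q
    have h := q.2
    unfold Prec at h
    rw [Prod.Lex.toLex_lt_toLex] at h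
    rcases h with h | h
    · exact h.le
    · exact h.1.le
  refine small_of_injective (β := Iic (max p.1 p.2) × Iic (max p.1 p.2))
    (f := fun q => (⟨q.1.1, (le_max_left _ _).trans (key q)⟩,
      ⟨q.1.2, (le_max_right _ _).trans (key q)⟩)) ?_
  intro a b h
  exact Subtype.ext (Prod.ext (congrArg (fun z => (z.1 : Ordinal)) h)
    (congrArg (fun z => (z.2 : Ordinal)) h))

/-- The order `≺` on the pairs before `p`, on the copy of this set in the universe `u`. -/
def BeforeRel (p : Ordinal.{u} × Ordinal.{u}) (a b : Shrink.{u} (Before p)) : Prop :=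
  Prec ((equivShrink (Before p)).symm a).1 ((equivShrink (Before p)).symm b).1

instance instIsWellOrderBeforeRel (p : Ordinal.{u} × Ordinal.{u}) :
    IsWellOrder (Shrink.{u} (Before p)) (BeforeRel p) :=
  RelEmbedding.isWellOrder (s := Prec.{u})
    { toFun := fun a => ((equivShrink (Before p)).symm a).1
      inj' := Subtype.val_injective.comp (equivShrink (Before p)).symm.injective
      map_rel_iff' := Iff.rfl }

/-- The Gödel pairing function: `pair α β` is the position of `⟨α, β⟩` in the well-order `≺`,
that is, the order type of the set of the pairs before `⟨α, β⟩`. -/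
noncomputable def pair (α β : Ordinal.{u}) : Ordinal.{u} := Ordinal.type (BeforeRel (α, β))

end Goedel

/-! ### Turing machines with tapes and running time of length `κ` -/

/-- The generalised Cantor space `2^κ`: the binary sequences of length `κ`. -/
abbrev Cantor (κ : Cardinal.{u}) : Type (u + 1) := Iio κ.ord → Bool

namespace KTM

/-- A move of a head. -/
inductive Move
  | left
  | stay
  | right

/-- What a machine does in one step: it changes its state, writes a symbol on each of its `k`
scratch tapes, moves the heads on the input tape and on the scratch tapes, and appends at most one
symbol to its output. The output tape is write-only: its head writes a symbol and moves on to the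
next cell, and can neither read nor go back. -/
structure Action (n k : ℕ) where
  state : Fin (n + 1)
  inputMove : Move
  write : Fin k → Bool
  move : Fin k → Move
  output : Option Bool

/-- A machine, given by its finite transition table: the action depends on the state, on the symbol
under the head of the read-only input tape, and on the symbols under the heads of the scratch
tapes. State `0` is the initial state. A halt amounts to staying forever in a configuration. -/
structure Machine where
  numStates : ℕ
  numTapes : ℕ
  trans : Fin (numStates + 1) → Bool → (Fin numTapes → Bool) → Action numStates numTapes

/-- A configuration. Cells are numbered by ordinals. A head starts at cell `0`, so that it is at a
cell `≤ t` at every time `t` (see `Machine.run_bounds`); the computations considered below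
have length `κ`, so they take place on tapes of length `κ`. -/
structure Config (n k : ℕ) : Type (u + 1) where
  state : Fin (n + 1)
  inputHead : Ordinal.{u}
  head : Fin k → Ordinal.{u}
  tape : Fin k → Ordinal.{u} → Bool
  outputHead : Ordinal.{u}
  outputTape : Ordinal.{u} → Bool

open Classical in
/-- The position of a head after a move. A left move from a cell `p + 1` leads to `p`, and a
left move from a cell with no immediate predecessor leads to cell `0`. -/
noncomputable def Move.apply : Move → Ordinal.{u} → Ordinal.{u}
  | .left, p => if Order.IsSuccPrelimit p then 0 else p.pred
  | .stay, p => p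
  | .right, p => p + 1

open Classical in
/-- The symbol in cell `p` of a tape on which `x` is written. -/
noncomputable def readInput {κ : Cardinal.{u}} (x : Cantor κ) (p : Ordinal.{u}) : Bool :=
  if h : p < κ.ord then x ⟨p, h⟩ else false

namespace Machine

variable (M : Machine)

/-- The initial configuration: every scratch cell and every output cell contains `0`. -/
def init : Config.{u} M.numStates M.numTapes where
  state := 0
  inputHead := 0
  head := fun _ => 0
  tape := fun _ _ => false
  outputHead := 0
  outputTape := fun _ => false

open Classical in
/-- One step of the machine on input `x`. -/
noncomputable def step {κ : Cardinal.{u}} (x : Cantor κ)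
    (c : Config.{u} M.numStates M.numTapes) : Config.{u} M.numStates M.numTapes :=
  let a := M.trans c.state (readInput x c.inputHead) (fun i => c.tape i (c.head i))
  { state := a.state
    inputHead := a.inputMove.apply c.inputHead
    head := fun i => (a.move i).apply (c.head i)
    tape := fun i => Function.update (c.tape i) (c.head i) (a.write i)
    outputHead := if a.output.isSome then c.outputHead + 1 else c.outputHead
    outputTape :=
      match a.output with
      | some b => Function.update c.outputTape c.outputHead b
      | none => c.outputTape }

/-- The configuration at a limit time `t`, computed from the earlier ones by inferior limits. The
limit of the position of a head is taken over the earlier times at which the machine was in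
its limit state. -/
noncomputable def limit {t : Ordinal.{u}} (c : Iio t → Config.{u} M.numStates M.numTapes) :
    Config.{u} M.numStates M.numTapes :=
  let s := liminf (fun r => (c r).state) atTop
  let F := (atTop : Filter (Iio t)) ⊓ 𝓟 {r | (c r).state = s}
  { state := s
    inputHead := liminf (fun r => (c r).inputHead) F
    head := fun i => liminf (fun r => (c r).head i) F
    tape := fun i p => liminf (fun r => (c r).tape i p) atTop
    outputHead := liminf (fun r => (c r).outputHead) F
    outputTape := fun p => liminf (fun r => (c r).outputTape p) atTop }

/-- The configuration of the machine at time `t` of its computation on input `x`. -/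
noncomputable def run {κ : Cardinal.{u}} (x : Cantor κ) (t : Ordinal.{u}) :
    Config.{u} M.numStates M.numTapes :=
  Ordinal.limitRecOn t M.init (fun _ c => M.step x c) (fun t _ c => M.limit fun r : Iio t => c r r.2)

theorem run_zero {κ : Cardinal.{u}} (x : Cantor κ) : M.run x 0 = M.init :=
  Ordinal.limitRecOn_zero ..

theorem run_add_one {κ : Cardinal.{u}} (x : Cantor κ) (t : Ordinal.{u}) :
    M.run x (t + 1) = M.step x (M.run x t) :=
  Ordinal.limitRecOn_add_one ..

theorem run_limit {κ : Cardinal.{u}} (x : Cantor κ) {t : Ordinal.{u}} (ht : Order.IsSuccLimit t) :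
    M.run x t = M.limit fun r : Iio t => M.run x r :=
  Ordinal.limitRecOn_limit _ _ _ _ ht

end Machine

theorem Move.apply_le (m : Move) (p : Ordinal.{u}) : m.apply p ≤ p + 1 := by
  have hp : p ≤ p + 1 := (Order.lt_add_one_iff.2 le_rfl).le
  cases m with
  | left =>
    simp only [Move.apply]
    split_ifs with h
    · exact zero_le
    · exact (Ordinal.pred_le_self p).trans hp
  | stay => exact hp
  | right => exact le_rfl

theorem liminf_head_le {t : Ordinal.{u}} (F : Filter (Iio t)) [F.NeBot] (f : Iio t → Ordinal.{u})
    (hf : ∀ r, f r ≤ r) : liminf f F ≤ t := by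
  refine csSup_le' ?_
  intro a ha
  obtain ⟨r, hr⟩ := Filter.Eventually.exists (f := F) ha
  exact hr.trans ((hf r).trans r.2.le)

theorem neBot_limitState {n : ℕ} {t : Ordinal.{u}} (ht : Order.IsSuccLimit t)
    (s : Iio t → Fin (n + 1)) :
    ((atTop : Filter (Iio t)) ⊓ 𝓟 {r | s r = liminf s atTop}).NeBot := by
  have : Nonempty (Iio t) := ⟨⟨0, ht.bot_lt⟩⟩
  rw [← frequently_mem_iff_neBot]
  intro hne
  have hmem : ∀ᶠ r in atTop, liminf s atTop ≤ s r :=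
    Set.Nonempty.csSup_mem (s := {a | ∀ᶠ r in atTop, a ≤ s r}) ⟨0, Eventually.of_forall fun _ => Fin.zero_le _⟩ (Set.toFinite _)
  have hlt : ∀ᶠ r in atTop, liminf s atTop < s r := by
    filter_upwards [hmem, hne] with r h₁ h₂
    exact lt_of_le_of_ne h₁ fun h => h₂ h.symm
  obtain ⟨r, hr⟩ := hlt.exists
  have hsucc : Order.succ (liminf s atTop) ≤ liminf s atTop :=
    le_liminf_of_le (by isBoundedDefault) (hlt.mono fun r h => Order.succ_le_of_lt h)
  exact (Order.lt_succ_of_not_isMax hr.not_isMax).not_ge hsucc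

namespace Machine

variable (M : Machine)

/-- At time `t` every head is at a cell `≤ t`. -/
theorem run_bounds {κ : Cardinal.{u}} (x : Cantor κ) (t : Ordinal.{u}) :
    (M.run x t).inputHead ≤ t ∧ (∀ i, (M.run x t).head i ≤ t) ∧ (M.run x t).outputHead ≤ t := by
  induction t using Ordinal.limitRecOn with
  | zero => simp [run_zero, init]
  | add_one t ih =>
    obtain ⟨h₁, h₂, h₃⟩ := ih
    rw [run_add_one]
    refine ⟨(Move.apply_le _ _).trans (by gcongr), fun i => (Move.apply_le _ _).trans ?_, ?_⟩
    · have := h₂ i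
      gcongr
    · simp only [step]
      split_ifs
      · gcongr
      · exact h₃.trans (Order.lt_add_one_iff.2 le_rfl).le
  | limit t ht ih =>
    rw [run_limit M x ht]
    have := neBot_limitState ht fun r : Iio t => (M.run x r).state
    exact ⟨liminf_head_le _ _ fun r => (ih r r.2).1,
      fun i => liminf_head_le _ _ fun r => (ih r r.2).2.1 i,
      liminf_head_le _ _ fun r => (ih r r.2).2.2⟩

/-- On input `x`, the machine produces the sequence `y` of length `κ`: for every `α < κ` there is
a stage `β < κ` at which the first `α` symbols of `y` have been written on the output tape. -/
def Outputs {κ : Cardinal.{u}} (x y : Cantor κ) : Prop :=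
  ∀ α < κ.ord, ∃ β < κ.ord, α ≤ (M.run x β).outputHead ∧
    ∀ ξ : Iio κ.ord, ξ.1 < α → (M.run x β).outputTape ξ = y ξ

/-- The machine, as a type two machine, computes the partial function `F : 2^κ → 2^κ`. -/
def Computes {κ : Cardinal.{u}} (F : Cantor κ →. Cantor κ) : Prop :=
  ∀ x y, y ∈ F x → M.Outputs x y

end Machine

/-- A partial function `2^κ → 2^κ` is computable if a type two `κ`-machine computes it. -/
def Computable {κ : Cardinal.{u}} (F : Cantor κ →. Cantor κ) : Prop :=
  ∃ M : Machine, M.Computes F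

end KTM

/-! ### Represented spaces -/

/-- A representation of `X`: a partial surjective function from `2^κ` to `X`. -/
structure KRep (κ : Cardinal.{u}) (X : Type v) where
  toPFun : Cantor κ →. X
  surjective : ∀ x, ∃ p, x ∈ toPFun p

namespace KRep

/-- The partial function `F` on `2^κ` is a realizer of `f`. -/
def Realizes {κ : Cardinal.{u}} {X : Type v} {Y : Type w} (δX : KRep κ X)
    (δY : KRep κ Y) (F : Cantor κ →. Cantor κ) (f : X → Y) : Prop :=
  ∀ p x, x ∈ δX.toPFun p → ∃ q ∈ F p, f x ∈ δY.toPFun q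

/-- `f` is `(δX, δY)`-computable: it has a computable realizer. -/
def IsComputable {κ : Cardinal.{u}} {X : Type v} {Y : Type w} (δX : KRep κ X)
    (δY : KRep κ Y) (f : X → Y) : Prop :=
  ∃ F : Cantor κ →. Cantor κ, KTM.Computable F ∧ δX.Realizes δY F f

open Classical in
/-- The sequence `0^α 1 0 0 0 …` of length `κ`. -/
noncomputable def code {κ : Cardinal.{u}} (α : Iio κ.ord) : Cantor κ := fun ξ => decide (ξ = α)

theorem code_injective {κ : Cardinal.{u}} : Function.Injective (code (κ := κ)) := by
  intro a b h
  simpa [code] using congrFun h a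

/-- The representation `δ_κ` of `κ`: the only name of `α` is `0^α 1 0 0 0 …`. -/
noncomputable def ord (κ : Cardinal.{u}) : KRep κ (Iio κ.ord) where
  toPFun p := ⟨∃ α, p = code α, fun h => h.choose⟩
  surjective α := ⟨code α, ⟨α, rfl⟩, code_injective (Exists.choose_spec (⟨α, rfl⟩ :
    ∃ β, code α = code β)).symm⟩

/-- The ordinals `2 * ξ`, for `ξ < κ`, are the even ordinals below `κ`: `2 * (l + n) = l + 2 * n`
for a limit ordinal `l` and a natural number `n`. -/
theorem two_mul_lt {κ : Cardinal.{u}} (hκ : Cardinal.aleph0 ≤ κ) {ξ : Ordinal.{u}}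
    (h : ξ < κ.ord) : 2 * ξ + 1 < κ.ord := by
  have hlim := Cardinal.isSuccLimit_ord hκ
  have h2 : (2 : Ordinal.{u}) < κ.ord := by
    exact_mod_cast (Ordinal.natCast_lt_omega0 2).trans_le (Cardinal.omega0_le_ord.2 hκ)
  exact hlim.add_one_lt (Ordinal.isPrincipal_mul_ord hκ h2 h)

/-- The symbols of `r` in even places. -/
def evenPart {κ : Cardinal.{u}} (hκ : Cardinal.aleph0 ≤ κ) (r : Cantor κ) : Cantor κ :=
  fun ξ => r ⟨2 * ξ.1, (Order.lt_add_one_iff.2 le_rfl).trans (two_mul_lt hκ ξ.2)⟩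

/-- The symbols of `r` in odd places. -/
def oddPart {κ : Cardinal.{u}} (hκ : Cardinal.aleph0 ≤ κ) (r : Cantor κ) : Cantor κ :=
  fun ξ => r ⟨2 * ξ.1 + 1, two_mul_lt hκ ξ.2⟩

theorem exists_interleave {κ : Cardinal.{u}} (hκ : Cardinal.aleph0 ≤ κ) (p q : Cantor κ) :
    ∃ r, evenPart hκ r = p ∧ oddPart hκ r = q := by
  have h2 : (2 : Ordinal.{u}) ≠ 0 := two_ne_zero
  have hlt : (1 : Ordinal.{u}) < 2 := one_lt_two
  have hle : ∀ ξ : Ordinal.{u}, ξ / 2 ≤ ξ := fun ξ =>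
    Ordinal.div_le_of_le_mul (Ordinal.le_mul_right ξ two_pos)
  refine ⟨fun ξ => if ξ.1 % 2 = 0 then p ⟨ξ.1 / 2, (hle _).trans_lt ξ.2⟩
    else q ⟨ξ.1 / 2, (hle _).trans_lt ξ.2⟩, ?_, ?_⟩
  · funext ξ
    simp [evenPart, Ordinal.mul_div_cancel _ h2]
  · funext ξ
    simp [oddPart, Ordinal.mul_add_mod_self, Ordinal.mul_add_div _ h2, Ordinal.mod_eq_of_lt hlt,
      Ordinal.div_eq_zero_of_lt hlt]

/-- The representation of the product `X × Y`: a name of `(x, y)` consists of a name of `x`, in the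
even places, and a name of `y`, in the odd places. -/
noncomputable def prod {κ : Cardinal.{u}} (hκ : Cardinal.aleph0 ≤ κ) {X : Type v} {Y : Type w}
    (δX : KRep κ X) (δY : KRep κ Y) : KRep κ (X × Y) where
  toPFun r := (δX.toPFun (evenPart hκ r)).bind fun x =>
    (δY.toPFun (oddPart hκ r)).map fun y => (x, y)
  surjective := by
    rintro ⟨x, y⟩
    obtain ⟨p, hp⟩ := δX.surjective x
    obtain ⟨q, hq⟩ := δY.surjective y
    obtain ⟨r, rfl, rfl⟩ := exists_interleave hκ p q
    exact ⟨r, by simpa using ⟨hp, hq⟩⟩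

end KRep

/-! Both machines run through the pairs in the order ≺, spending a fixed finite number of steps on
each, so that the pair treated at stage `i` is the one with number `i`. The pairs with maximum m
form two rows, (0,m), (1,m), … and then (m,0), …, (m,m). A head A carries the varying coordinate in
the first row and a head B in the second, while the other head returns to cell 0. The return is
fast: a left move from a limit cell goes to 0, so by well-foundedness it takes finitely many steps
(`exists_retreat_eq_zero`). Each head marks the cells it visits, and an unmarked cell tells it that
it stands at m.

The crux is that inferior limits preserve this picture (`isScanLimit`). A limit pair has one of
three shapes (`unpair_limit_cases`). If it ends a limit stretch of one row, the phase is constant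
near it, the advancing head converges and the other head already rests at 0. If it is (0,m) with m a
limit, the inferior limit selects the lower state, in which each head is at 0 cofinally often. The
theorem `run_eq_of_blocks` turns a successor rule and a limit rule of this kind into a description
of the run.

To compute the pairing function, the machine appends 0 for every pair that differs from the input
and 1 for the one that agrees. The symbols of the two names are copied to scratch tapes as the
maximum grows, so they can be consulted at the heads. To invert it, the machine reads one input cell
per pair, stops at the 1, marks where the heads stand, rewinds, and writes both names in alternation
up to the maximum. Both end by appending zeros forever (`outputs_of_isFinal`).

Bijectivity holds because `pair` is the rank function of ≺, its values `pair 0 i ≥ i` are unbounded,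
and fewer than κ pairs precede a given pair of ordinals below κ. -/

namespace KTM

/-! ### Inferior limits at limit times -/

/-- `P` holds at all sufficiently large ordinals below `l`. -/
def EventuallyBelow (l : Ordinal.{u}) (P : Ordinal.{u} → Prop) : Prop :=
  ∃ a < l, ∀ i, a ≤ i → i < l → P i

/-- `P` holds at arbitrarily large ordinals below `l`. -/
def FrequentlyBelow (l : Ordinal.{u}) (P : Ordinal.{u} → Prop) : Prop :=
  ∀ a < l, ∃ i, a ≤ i ∧ i < l ∧ P i

theorem EventuallyBelow.of_forall {l : Ordinal.{u}} {P : Ordinal.{u} → Prop} (hl : 0 < l)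
    (h : ∀ i < l, P i) : EventuallyBelow l P :=
  ⟨0, hl, fun i _ hi => h i hi⟩

theorem EventuallyBelow.mono {l : Ordinal.{u}} {P Q : Ordinal.{u} → Prop}
    (h : EventuallyBelow l P) (hPQ : ∀ i < l, P i → Q i) : EventuallyBelow l Q :=
  let ⟨a, ha, H⟩ := h
  ⟨a, ha, fun i h₁ h₂ => hPQ i h₂ (H i h₁ h₂)⟩

theorem EventuallyBelow.and {l : Ordinal.{u}} {P Q : Ordinal.{u} → Prop}
    (h : EventuallyBelow l P) (h' : EventuallyBelow l Q) :
    EventuallyBelow l fun i => P i ∧ Q i :=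
  let ⟨a, ha, H⟩ := h
  let ⟨b, hb, H'⟩ := h'
  ⟨max a b, max_lt ha hb, fun i h₁ h₂ =>
    ⟨H i ((le_max_left _ _).trans h₁) h₂, H' i ((le_max_right _ _).trans h₁) h₂⟩⟩

theorem FrequentlyBelow.mono {l : Ordinal.{u}} {P Q : Ordinal.{u} → Prop}
    (h : FrequentlyBelow l P) (hPQ : ∀ i < l, P i → Q i) : FrequentlyBelow l Q := by
  intro a ha
  obtain ⟨i, h₁, h₂, h₃⟩ := h a ha
  exact ⟨i, h₁, h₂, hPQ i h₂ h₃⟩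

theorem FrequentlyBelow.of_forall {l : Ordinal.{u}} {P : Ordinal.{u} → Prop}
    (h : ∀ i < l, P i) : FrequentlyBelow l P :=
  fun a ha => ⟨a, le_rfl, ha, h a ha⟩

theorem EventuallyBelow.atTop {l : Ordinal.{u}} {P : Ordinal.{u} → Prop}
    (h : EventuallyBelow l P) : ∀ᶠ r : Iio l in atTop, P r := by
  obtain ⟨a, ha, H⟩ := h
  filter_upwards [eventually_ge_atTop (⟨a, ha⟩ : Iio l)] with r hr
  exact H r hr r.2

theorem FrequentlyBelow.atTop {l : Ordinal.{u}} (hl : 0 < l) {P : Ordinal.{u} → Prop}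
    (h : FrequentlyBelow l P) : ∃ᶠ r : Iio l in atTop, P r := by
  have : Nonempty (Iio l) := ⟨⟨0, hl⟩⟩
  rw [frequently_atTop]
  intro a
  obtain ⟨i, h₁, h₂, h₃⟩ := h a a.2
  exact ⟨⟨i, h₂⟩, h₁, h₃⟩

/-- `L` is the inferior limit of `f` at `l`, taken over the places where `p` holds. -/
structure IsLiminfBelow (l : Ordinal.{u}) (p : Ordinal.{u} → Prop) (f : Ordinal.{u} → Ordinal.{u})
    (L : Ordinal.{u}) : Prop where
  eventually : ∀ a < L, EventuallyBelow l fun i => p i → a < f i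
  frequently : FrequentlyBelow l fun i => p i ∧ f i ≤ L

theorem IsLiminfBelow.const {l : Ordinal.{u}} (hl : 0 < l) {p : Ordinal.{u} → Prop}
    (hp : FrequentlyBelow l p) (L : Ordinal.{u}) : IsLiminfBelow l p (fun _ => L) L :=
  ⟨fun _ ha => .of_forall hl fun _ _ _ => ha, hp.mono fun _ _ h => ⟨h, le_rfl⟩⟩

theorem IsLiminfBelow.liminf_eq {l : Ordinal.{u}} (hl : 0 < l) {p : Ordinal.{u} → Prop}
    {f : Ordinal.{u} → Ordinal.{u}} {L : Ordinal.{u}} (h : IsLiminfBelow l p f L) :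
    liminf (fun r : Iio l => f r) (atTop ⊓ 𝓟 {r | p r}) = L := by
  have hfr : ∃ᶠ r : Iio l in atTop ⊓ 𝓟 {r | p r}, f r ≤ L := by
    rw [frequently_inf_principal]
    exact (h.frequently.atTop hl).mono fun r hr => hr
  refine le_antisymm (liminf_le_of_frequently_le hfr (by isBoundedDefault)) ?_
  refine le_of_forall_lt fun a ha => ?_
  -- The ordinals have no greatest element, so a lower bound for an inferior limit needs
  -- coboundedness, which the cofinal bound `hfr` supplies.
  refine (Order.lt_succ a).trans_le (le_liminf_of_le (IsCoboundedUnder.of_frequently_le hfr) ?_)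
  rw [eventually_inf_principal]
  filter_upwards [(h.eventually a ha).atTop] with r hr hp
  exact Order.succ_le_of_lt (hr hp)

theorem liminf_eq_of_eventuallyBelow {α : Type*} [ConditionallyCompleteLattice α]
    {l : Ordinal.{u}} (hl : 0 < l) {f : Ordinal.{u} → α} {a : α}
    (h : EventuallyBelow l fun i => f i = a) : liminf (fun r : Iio l => f r) atTop = a := by
  have : Nonempty (Iio l) := ⟨⟨0, hl⟩⟩
  rw [liminf_congr (v := fun _ => a) h.atTop, liminf_const]

theorem liminf_state_eq {n : ℕ} {l : Ordinal.{u}} (hl : 0 < l) {f : Ordinal.{u} → Fin (n + 1)}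
    {a : Fin (n + 1)} (h : EventuallyBelow l fun i => a ≤ f i)
    (h' : FrequentlyBelow l fun i => f i = a) : liminf (fun r : Iio l => f r) atTop = a := by
  have hfr : ∃ᶠ r : Iio l in atTop, f r ≤ a := (h'.atTop hl).mono fun r hr => hr.le
  exact le_antisymm (liminf_le_of_frequently_le hfr (by isBoundedDefault))
    (le_liminf_of_le (by isBoundedDefault) h.atTop)

/-- Componentwise conditions under which `d` is the configuration at the limit time `l` after the
configurations `c`. -/
structure IsLimitConfig {n k : ℕ} (l : Ordinal.{u}) (c : Ordinal.{u} → Config.{u} n k)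
    (d : Config.{u} n k) : Prop where
  state : EventuallyBelow l fun i => d.state ≤ (c i).state
  inputHead : IsLiminfBelow l (fun i => (c i).state = d.state) (fun i => (c i).inputHead)
    d.inputHead
  head : ∀ t, IsLiminfBelow l (fun i => (c i).state = d.state) (fun i => (c i).head t) (d.head t)
  outputHead : IsLiminfBelow l (fun i => (c i).state = d.state) (fun i => (c i).outputHead)
    d.outputHead
  tape : ∀ t p, EventuallyBelow l fun i => (c i).tape t p = d.tape t p
  outputTape : ∀ p, EventuallyBelow l fun i => (c i).outputTape p = d.outputTape p

theorem IsLimitConfig.limit_eq {M : Machine} {l : Ordinal.{u}} (hl : 0 < l)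
    {c : Ordinal.{u} → Config.{u} M.numStates M.numTapes} {d : Config.{u} M.numStates M.numTapes}
    (h : IsLimitConfig l c d) : M.limit (fun r : Iio l => c r) = d := by
  -- That the limit state recurs cofinally is contained in the condition on the input head.
  have hs : liminf (fun r : Iio l => (c r).state) atTop = d.state :=
    liminf_state_eq (f := fun r => (c r).state) hl h.state
      (h.inputHead.frequently.mono fun i _ hi => hi.1)
  obtain ⟨ds, di, dh, dt, doh, dot⟩ := d
  simp only [Machine.limit, hs, Config.mk.injEq, true_and]
  exact ⟨h.inputHead.liminf_eq hl, funext fun t => (h.head t).liminf_eq hl,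
    funext fun t => funext fun p =>
      liminf_eq_of_eventuallyBelow (f := fun r => (c r).tape t p) hl (h.tape t p),
    h.outputHead.liminf_eq hl,
    funext fun p => liminf_eq_of_eventuallyBelow (f := fun r => (c r).outputTape p) hl
      (h.outputTape p)⟩

/-! ### Runs cut into blocks of finite length -/

/-- Euclidean division of `r - τ` by `k`: the ordinal `k * i` is `i` consecutive blocks of length
`k`, so the quotient is the block and the remainder the place in it. -/
theorem exists_block {τ l r : Ordinal.{u}} {k : ℕ} (hk : 0 < k) (h₁ : τ ≤ r) (h₂ : r < τ + k * l) :
    ∃ i < l, ∃ j : ℕ, j < k ∧ r = τ + k * i + j := by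
  have hk' : (k : Ordinal.{u}) ≠ 0 := by exact_mod_cast hk.ne'
  have hr : r = τ + (r - τ) := (Ordinal.add_sub_cancel_of_le h₁).symm
  have hlt : r - τ < k * l := by
    rw [hr] at h₂
    exact (add_lt_add_iff_left τ).1 h₂
  have hm : (r - τ) % k < k := Ordinal.mod_lt _ hk'
  obtain ⟨j, hj⟩ := Ordinal.lt_omega0.1 (hm.trans (Ordinal.natCast_lt_omega0 k))
  refine ⟨(r - τ) / k, (Ordinal.lt_mul_iff_div_lt hk').1 hlt, j, ?_, ?_⟩
  · rw [hj] at hm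
    exact_mod_cast hm
  · rw [add_assoc, ← hj, Ordinal.div_add_mod, ← hr]

theorem block_le {τ a i : Ordinal.{u}} {k j : ℕ} (hjk : j < k)
    (h : τ + k * a ≤ τ + k * i + j) : a ≤ i := by
  by_contra! hlt
  have h1 : (k : Ordinal.{u}) * i + j < k * (i + 1) := by
    rw [mul_add, mul_one]
    exact (add_lt_add_iff_left _).2 (by exact_mod_cast hjk)
  have h2 : (k : Ordinal.{u}) * (i + 1) ≤ k * a := mul_le_mul_right (Order.add_one_le_of_lt hlt) _
  rw [add_assoc] at h
  exact absurd ((add_le_add_iff_left τ).1 h) (h1.trans_le h2).not_ge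

theorem block_lt {τ l i : Ordinal.{u}} {k j : ℕ} (hjk : j < k) (h : i < l) :
    τ + k * i + j < τ + k * l := by
  rw [add_assoc]
  refine (add_lt_add_iff_left τ).2 ?_
  have h1 : (k : Ordinal.{u}) * i + j < k * (i + 1) := by
    rw [mul_add, mul_one]
    exact (add_lt_add_iff_left _).2 (by exact_mod_cast hjk)
  exact h1.trans_le (mul_le_mul_right (Order.add_one_le_of_lt h) _)

theorem EventuallyBelow.blocks {τ l : Ordinal.{u}} {k : ℕ} (hk : 0 < k) {P : Ordinal.{u} → Prop}
    {Q : Ordinal.{u} → Prop} (h : EventuallyBelow l P)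
    (hPQ : ∀ i < l, P i → ∀ j : ℕ, j < k → Q (τ + k * i + j)) :
    EventuallyBelow (τ + k * l) Q := by
  obtain ⟨a, ha, H⟩ := h
  refine ⟨τ + k * a, ?_, fun r h₁ h₂ => ?_⟩
  · simpa using block_lt (τ := τ) hk ha
  · obtain ⟨i, hi, j, hj, rfl⟩ := exists_block hk (le_self_add.trans h₁) h₂
    exact hPQ i hi (H i (block_le hj h₁) hi) j hj

theorem FrequentlyBelow.blocks {τ l : Ordinal.{u}} {k : ℕ} (hk : 0 < k) (hl : Order.IsSuccLimit l)
    {P : Ordinal.{u} → Prop} {Q : Ordinal.{u} → Prop} (h : FrequentlyBelow l P)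
    (hPQ : ∀ i < l, P i → Q (τ + k * i)) : FrequentlyBelow (τ + k * l) Q := by
  intro r hr
  rcases lt_or_ge r τ with hlt | hle
  · obtain ⟨i, -, h₂, h₃⟩ := h 0 hl.bot_lt
    exact ⟨τ + k * i, hlt.le.trans le_self_add, by simpa using block_lt (τ := τ) hk h₂,
      hPQ i h₂ h₃⟩
  · obtain ⟨b, hb, j, hj, rfl⟩ := exists_block hk hle hr
    obtain ⟨i, h₁, h₂, h₃⟩ := h (b + 1) (hl.add_one_lt hb)
    have hi : τ + k * i < τ + k * l := by simpa using block_lt (τ := τ) hk h₂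
    refine ⟨τ + k * i, ?_, hi, hPQ i h₂ h₃⟩
    exact (block_lt hj (Order.add_one_le_iff.1 h₁)).le

/-- Times strictly inside a block violate `p'`, so they do not enter the inferior limit and only the
starts of blocks count. -/
theorem IsLiminfBelow.blocks {τ l : Ordinal.{u}} {k : ℕ} (hk : 0 < k) (hl : Order.IsSuccLimit l)
    {p p' : Ordinal.{u} → Prop} {f f' : Ordinal.{u} → Ordinal.{u}} {L : Ordinal.{u}}
    (h : IsLiminfBelow l p f L) (hp : ∀ i < l, (p' (τ + k * i) ↔ p i))
    (hf : ∀ i < l, f' (τ + k * i) = f i)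
    (hmid : ∀ i < l, ∀ j : ℕ, 0 < j → j < k → ¬ p' (τ + k * i + j)) :
    IsLiminfBelow (τ + k * l) p' f' L where
  eventually a ha := by
    refine (h.eventually a ha).blocks hk fun i hi hpi j hj hp' => ?_
    rcases Nat.eq_zero_or_pos j with rfl | hj0
    · simp only [Nat.cast_zero, add_zero] at hp' ⊢
      rw [hf i hi]
      exact hpi ((hp i hi).1 hp')
    · exact absurd hp' (hmid i hi j hj0 hj)
  frequently := h.frequently.blocks hk hl fun i hi hpi => ⟨(hp i hi).2 hpi.1, by
    rw [hf i hi]; exact hpi.2⟩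

/-- Conditions under which the configuration `C l` is the limit of the configurations of a
computation that proceeds in blocks of `k` steps, from `C i` to `C (i + 1)` for `i < l`. Only the
configurations `C i` at the start of a block may have the limit state. -/
structure IsBlockLimit {κ : Cardinal.{u}} (M : Machine) (x : Cantor κ) (k : ℕ)
    (C : Ordinal.{u} → Config.{u} M.numStates M.numTapes) (l : Ordinal.{u}) : Prop where
  state : EventuallyBelow l fun i => (C l).state ≤ (C i).state
  state_mid : ∀ i < l, ∀ j, 0 < j → j < k → (C l).state < ((M.step x)^[j] (C i)).state
  inputHead : IsLiminfBelow l (fun i => (C i).state = (C l).state) (fun i => (C i).inputHead)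
    (C l).inputHead
  head : ∀ t, IsLiminfBelow l (fun i => (C i).state = (C l).state) (fun i => (C i).head t)
    ((C l).head t)
  outputHead : IsLiminfBelow l (fun i => (C i).state = (C l).state) (fun i => (C i).outputHead)
    (C l).outputHead
  tape : ∀ t p, EventuallyBelow l fun i =>
    ∀ j < k, ((M.step x)^[j] (C i)).tape t p = (C l).tape t p
  outputTape : ∀ p, EventuallyBelow l fun i =>
    ∀ j < k, ((M.step x)^[j] (C i)).outputTape p = (C l).outputTape p

namespace Machine

variable (M : Machine)

theorem run_add_nat {κ : Cardinal.{u}} (x : Cantor κ) (t : Ordinal.{u}) (j : ℕ) :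
    M.run x (t + j) = (M.step x)^[j] (M.run x t) := by
  induction j with
  | zero => simp
  | succ j ih => rw [Nat.cast_succ, ← add_assoc, run_add_one, ih, Function.iterate_succ_apply']

/-- Transfinite induction on the number of blocks. At a limit, the steps inside blocks are in states
above the limit state; they affect neither the inferior limit of the states nor the positions of the
heads. -/
theorem run_eq_of_blocks {κ : Cardinal.{u}} {x : Cantor κ} {τ N : Ordinal.{u}} {k : ℕ} (hk : 0 < k)
    {C : Ordinal.{u} → Config.{u} M.numStates M.numTapes} (h_zero : M.run x τ = C 0)
    (h_step : ∀ i < N, (M.step x)^[k] (C i) = C (i + 1))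
    (h_limit : ∀ l ≤ N, Order.IsSuccLimit l → IsBlockLimit M x k C l) :
    ∀ i ≤ N, M.run x (τ + k * i) = C i := by
  intro i
  induction i using Ordinal.limitRecOn with
  | zero => simpa using h_zero
  | add_one i ih =>
    intro hi
    have hlt : i < N := Order.add_one_le_iff.1 hi
    rw [mul_add, mul_one, ← add_assoc, run_add_nat, ih hlt.le, h_step i hlt]
  | limit l hl ih =>
    intro hlN
    have hk' : (0 : Ordinal.{u}) < k := by exact_mod_cast hk
    have H := h_limit l hlN hl
    have hrun : ∀ i < l, M.run x (τ + k * i) = C i := fun i hi => ih i hi (hi.le.trans hlN)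
    have hrun' : ∀ i < l, ∀ j : ℕ, M.run x (τ + k * i + j) = (M.step x)^[j] (C i) :=
      fun i hi j => by rw [run_add_nat, hrun i hi]
    have ht : Order.IsSuccLimit (τ + k * l) :=
      Ordinal.isSuccLimit_add _ (Ordinal.isSuccLimit_mul_right hk' hl)
    have hp : ∀ i < l, ((M.run x (τ + k * i)).state = (C l).state ↔ (C i).state = (C l).state) :=
      fun i hi => by rw [hrun i hi]
    have hmid : ∀ i < l, ∀ j : ℕ, 0 < j → j < k →
        ¬ (M.run x (τ + k * i + j)).state = (C l).state := fun i hi j h0 hj => by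
      rw [hrun' i hi]
      exact (H.state_mid i hi j h0 hj).ne'
    rw [run_limit M x ht]
    refine IsLimitConfig.limit_eq (c := M.run x) ht.bot_lt ⟨?_, ?_, fun t => ?_, ?_, fun t p => ?_,
      fun p => ?_⟩
    · refine H.state.blocks hk fun i hi h j hj => ?_
      rw [hrun' i hi]
      rcases Nat.eq_zero_or_pos j with rfl | hj0
      · exact h
      · exact (H.state_mid i hi j hj0 hj).le
    · exact H.inputHead.blocks hk hl hp (fun i hi => by rw [hrun i hi]) hmid
    · exact (H.head t).blocks hk hl hp (fun i hi => by rw [hrun i hi]) hmid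
    · exact H.outputHead.blocks hk hl hp (fun i hi => by rw [hrun i hi]) hmid
    · exact (H.tape t p).blocks hk fun i hi h j hj => by rw [hrun' i hi]; exact h j hj
    · exact (H.outputTape p).blocks hk fun i hi h j hj => by rw [hrun' i hi]; exact h j hj

/-- In state `d` the machine changes nothing except that it appends a `0` to its output. -/
def IsFinal (d : Fin (M.numStates + 1)) : Prop :=
  ∀ b r, M.trans d b r = ⟨d, .stay, r, fun _ => .stay, some false⟩

theorem outputs_of_isFinal {κ : Cardinal.{u}} (hκ : Cardinal.aleph0 ≤ κ) {x y : Cantor κ}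
    {d : Fin (M.numStates + 1)}
    (hd : M.IsFinal d) {τ : Ordinal.{u}} (hτ : τ < κ.ord) (hs : (M.run x τ).state = d)
    (hfree : ∀ p, (M.run x τ).outputHead ≤ p → (M.run x τ).outputTape p = false)
    (hy : ∀ ξ : Iio κ.ord, (M.run x τ).outputTape ξ = y ξ) : M.Outputs x y := by
  set c := M.run x τ with hc
  let C : Ordinal.{u} → Config.{u} M.numStates M.numTapes :=
    fun i => { c with outputHead := c.outputHead + i }
  have key : ∀ i, M.run x (τ + i) = C i := by
    intro i
    have := M.run_eq_of_blocks (x := x) (τ := τ) (N := i) (k := 1) one_pos (C := C)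
      (by simp [C, hc]) ?_ ?_ i le_rfl
    · simpa using this
    · intro i _
      -- The cells from the output head onward are blank, so writing 0 there changes nothing.
      have hu : Function.update c.outputTape (c.outputHead + i) false = c.outputTape := by
        rw [← hfree (c.outputHead + i) le_self_add, Function.update_eq_self]
      have hd' : ∀ b r, M.trans c.state b r = ⟨d, .stay, r, fun _ => .stay, some false⟩ :=
        hs.symm ▸ hd
      subst hs
      simp [step, C, hd', Move.apply, hu, add_assoc]
    · intro l _ hl
      have hl0 : 0 < l := hl.bot_lt
      have hfr : FrequentlyBelow l fun i => (C i).state = (C l).state := .of_forall fun _ _ => rfl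
      refine ⟨.of_forall hl0 fun _ _ => le_rfl, fun i _ j h1 h2 => by omega, .const hl0 hfr _,
        fun t => .const hl0 hfr _, ⟨fun a ha => ?_, ?_⟩, fun t p => .of_forall hl0 ?_,
        fun p => .of_forall hl0 ?_⟩
      · obtain ⟨b, hb, hab⟩ := (Ordinal.lt_add_iff_of_isSuccLimit hl).1 ha
        exact ⟨b, hb, fun i hi _ _ => hab.trans_le (by dsimp only [C]; gcongr)⟩
      · exact .of_forall fun i hi => ⟨rfl, by dsimp only [C]; gcongr⟩
      · intro i _ j hj
        obtain rfl : j = 0 := by omega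
        rfl
      · intro i _ j hj
        obtain rfl : j = 0 := by omega
        rfl
  intro α hα
  -- One symbol is appended per step, so `α` more steps carry the output head to `α` or beyond.
  refine ⟨τ + α, Ordinal.isPrincipal_add_ord hκ hτ hα, ?_, fun ξ _ => ?_⟩
  · rw [key]
    exact le_add_self
  · rw [key]
    exact hy ξ

end Machine

end KTM

/-- The realizer chooses, for each name, one name of the value that `M` produces. A name has only
one point, so the chosen sequence names the right value. -/
theorem KRep.isComputable_of_outputs {κ : Cardinal.{u}} {X : Type v} {Y : Type w} {δX : KRep κ X}
    {δY : KRep κ Y} {f : X → Y} (M : KTM.Machine)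
    (h : ∀ p x, x ∈ δX.toPFun p → ∃ q, f x ∈ δY.toPFun q ∧ M.Outputs p q) :
    KRep.IsComputable δX δY f := by
  refine ⟨fun p => ⟨∃ q, ∃ x, x ∈ δX.toPFun p ∧ f x ∈ δY.toPFun q ∧ M.Outputs p q,
    fun h => h.choose⟩, ⟨M, ?_⟩, ?_⟩
  · rintro p q ⟨hd, rfl⟩
    obtain ⟨x, -, -, h⟩ := hd.choose_spec
    exact h
  · intro p x hx
    obtain ⟨q, hq, hout⟩ := h p x hx
    have hd : ∃ q, ∃ x, x ∈ δX.toPFun p ∧ f x ∈ δY.toPFun q ∧ M.Outputs p q := ⟨q, x, hx, hq, hout⟩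
    refine ⟨hd.choose, ⟨hd, rfl⟩, ?_⟩
    obtain ⟨x', hx', hfx', -⟩ := hd.choose_spec
    rwa [Part.mem_unique hx hx']

/-! ### The pairing function as the rank function of ≺ -/

namespace Goedel

theorem prec_iff {p q : Ordinal.{u} × Ordinal.{u}} :
    Prec p q ↔ max p.1 p.2 < max q.1 q.2 ∨
      max p.1 p.2 = max q.1 q.2 ∧ (p.1 < q.1 ∨ p.1 = q.1 ∧ p.2 < q.2) := by
  rw [Prec, Prod.Lex.toLex_lt_toLex, Prod.Lex.toLex_lt_toLex]

/-- By transitivity, the pairs before `p` that also precede q are all the pairs before q. Hence the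
rank of q does not depend on the initial segment in which it is computed. -/
theorem typein_beforeRel (p : Ordinal.{u} × Ordinal.{u}) (a : Shrink.{u} (Before p)) :
    Ordinal.typein (BeforeRel p) a =
      pair ((equivShrink (Before p)).symm a).1.1 ((equivShrink (Before p)).symm a).1.2 := by
  set q := ((equivShrink (Before p)).symm a) with hq
  rw [← Ordinal.type_subrel, pair, Ordinal.type_eq]
  refine ⟨⟨⟨fun b => equivShrink (Before q.1) ⟨((equivShrink (Before p)).symm b.1).1, b.2⟩,
    fun c => ⟨equivShrink (Before p) ⟨((equivShrink (Before q.1)).symm c).1,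
      trans_of Prec ((equivShrink (Before q.1)).symm c).2 q.2⟩, ?_⟩, ?_, ?_⟩, ?_⟩⟩
  · simp only [BeforeRel, Equiv.symm_apply_apply]
    exact ((equivShrink (Before q.1)).symm c).2
  · intro b
    simp
  · intro c
    simp
  · intro b c
    change Prec ((equivShrink (Before q.1)).symm (equivShrink (Before q.1) _)).1
      ((equivShrink (Before q.1)).symm (equivShrink (Before q.1) _)).1 ↔ _
    rw [Equiv.symm_apply_apply, Equiv.symm_apply_apply]
    rfl

theorem pair_lt_pair {p q : Ordinal.{u} × Ordinal.{u}} (h : Prec p q) :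
    pair p.1 p.2 < pair q.1 q.2 := by
  have := typein_beforeRel q (equivShrink (Before q) ⟨p, h⟩)
  rw [Equiv.symm_apply_apply] at this
  rw [← this]
  exact Ordinal.typein_lt_type _ _

theorem exists_pair_eq {i : Ordinal.{u}} {p : Ordinal.{u} × Ordinal.{u}} (h : i < pair p.1 p.2) :
    ∃ q, Prec q p ∧ pair q.1 q.2 = i := by
  obtain ⟨a, rfl⟩ := Ordinal.typein_surj (BeforeRel p) h
  exact ⟨_, ((equivShrink (Before p)).symm a).2, (typein_beforeRel p a).symm⟩

theorem pair_lt_pair_iff {p q : Ordinal.{u} × Ordinal.{u}} :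
    pair p.1 p.2 < pair q.1 q.2 ↔ Prec p q := by
  refine ⟨fun h => ?_, pair_lt_pair⟩
  rcases trichotomous_of Prec p q with h' | rfl | h'
  · exact h'
  · exact absurd h (lt_irrefl _)
  · exact absurd h (pair_lt_pair h').not_gt

theorem pair_injective : Function.Injective fun p : Ordinal.{u} × Ordinal.{u} => pair p.1 p.2 := by
  intro p q h
  rcases trichotomous_of Prec p q with h' | h' | h'
  · exact absurd h (pair_lt_pair h').ne
  · exact h'
  · exact absurd h (pair_lt_pair h').ne'

theorem self_le_pair_zero (i : Ordinal.{u}) : i ≤ pair 0 i := by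
  have : StrictMono fun i : Ordinal.{u} => pair 0 i := fun i j h =>
    pair_lt_pair (p := (0, i)) (q := (0, j)) (prec_iff.2 (Or.inl (by simpa using h)))
  exact this.le_apply

/-- Since `i < i + 1 ≤ pair 0 (i + 1)`, the ordinal `i` is the rank of some q. If the maximum of q
exceeded `i`, then (0,i) ≺ q would give `i ≤ pair 0 i < i`. -/
theorem exists_pair (i : Ordinal.{u}) : ∃ p : Ordinal.{u} × Ordinal.{u}, max p.1 p.2 ≤ i ∧
    pair p.1 p.2 = i := by
  obtain ⟨q, hq, h⟩ := exists_pair_eq (i := i) (p := (0, i + 1))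
    ((Order.lt_add_one_iff.2 le_rfl).trans_le (self_le_pair_zero _))
  refine ⟨q, ?_, h⟩
  by_contra! hlt
  have h0 : Prec (0, i) q := prec_iff.2 (Or.inl (by simpa using hlt))
  have := (self_le_pair_zero i).trans_lt (pair_lt_pair h0)
  exact absurd h this.ne'

/-- The pair with the number `i` in the order `≺`. -/
noncomputable def unpair (i : Ordinal.{u}) : Ordinal.{u} × Ordinal.{u} := (exists_pair i).choose

theorem max_unpair_le (i : Ordinal.{u}) : max (unpair i).1 (unpair i).2 ≤ i :=
  (exists_pair i).choose_spec.1

theorem pair_unpair (i : Ordinal.{u}) : pair (unpair i).1 (unpair i).2 = i :=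
  (exists_pair i).choose_spec.2

theorem unpair_pair (p : Ordinal.{u} × Ordinal.{u}) : unpair (pair p.1 p.2) = p :=
  pair_injective (pair_unpair _)

theorem prec_unpair {i j : Ordinal.{u}} : Prec (unpair i) (unpair j) ↔ i < j := by
  rw [← pair_lt_pair_iff, pair_unpair, pair_unpair]

theorem unpair_injective : Function.Injective unpair.{u} :=
  Function.LeftInverse.injective (g := fun p : Ordinal × Ordinal => pair p.1 p.2) pair_unpair

theorem max_unpair_mono {i j : Ordinal.{u}} (h : i ≤ j) :
    max (unpair i).1 (unpair i).2 ≤ max (unpair j).1 (unpair j).2 := by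
  rcases h.eq_or_lt with rfl | h
  · exact le_rfl
  · rcases prec_iff.1 (prec_unpair.2 h) with h | h
    · exact h.le
    · exact h.1.le

/-- With μ the larger component, at most |μ + 1|² pairs come before, and this product of two
cardinals below the infinite κ stays below κ. -/
theorem pair_lt_ord {κ : Cardinal.{u}} (hκ : Cardinal.aleph0 ≤ κ) {α β : Ordinal.{u}}
    (hα : α < κ.ord) (hβ : β < κ.ord) : pair α β < κ.ord := by
  have hmκ : max α β + 1 < κ.ord := (Cardinal.isSuccLimit_ord hκ).add_one_lt (max_lt hα hβ)
  have hmem : ∀ q : Before (α, β), max q.1.1 q.1.2 < max α β + 1 := fun q => by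
    rw [Order.lt_add_one_iff]
    rcases prec_iff.1 q.2 with h | h
    · exact h.le
    · exact h.1.le
  have hinj : Function.Injective fun q : Before (α, β) =>
      ((⟨q.1.1, (le_max_left _ _).trans_lt (hmem q)⟩,
        ⟨q.1.2, (le_max_right _ _).trans_lt (hmem q)⟩) :
          Iio (max α β + 1) × Iio (max α β + 1)) := by
    intro a b h
    exact Subtype.ext (Prod.ext (congrArg (fun z => (z.1 : Ordinal)) h)
      (congrArg (fun z => (z.2 : Ordinal)) h))
  have hcard := Cardinal.mk_le_of_injective hinj
  rw [Cardinal.mk_prod, Cardinal.mk_Iio_ordinal, Cardinal.lift_lift, ← Cardinal.lift_mul] at hcard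
  have hlt : (max α β + 1).card * (max α β + 1).card < κ :=
    Cardinal.mul_lt_of_lt hκ (Cardinal.lt_ord.1 hmκ) (Cardinal.lt_ord.1 hmκ)
  rw [Cardinal.lt_ord, pair, Ordinal.card_type, ← Cardinal.lift_lt.{u, u + 1}]
  have hshrink : Cardinal.lift.{u + 1} (Cardinal.mk (Shrink.{u} (Before (α, β)))) =
      Cardinal.mk (Before (α, β)) := by
    rw [← Cardinal.lift_id'.{u, u + 1} (Cardinal.mk (Before (α, β)))]
    exact Cardinal.lift_mk_eq'.2 ⟨(equivShrink (Before (α, β))).symm⟩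
  rw [hshrink]
  exact hcard.trans_lt (Cardinal.lift_lt.2 hlt)

/-- The Gödel pairing function as a bijection between `κ × κ` and `κ`. -/
noncomputable def pairEquiv {κ : Cardinal.{u}} (hκ : Cardinal.aleph0 ≤ κ) :
    (Iio κ.ord × Iio κ.ord) ≃ Iio κ.ord where
  toFun p := ⟨pair p.1 p.2, pair_lt_ord hκ p.1.2 p.2.2⟩
  invFun i := (⟨(unpair i).1, ((le_max_left _ _).trans (max_unpair_le _)).trans_lt i.2⟩,
    ⟨(unpair i).2, ((le_max_right _ _).trans (max_unpair_le _)).trans_lt i.2⟩)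
  left_inv p := by
    have := unpair_pair (p.1.1, p.2.1)
    ext <;> simp [this]
  right_inv i := Subtype.ext (pair_unpair _)

end Goedel

/-! ### Heads that move left -/

namespace KTM

namespace Move

theorem left_apply_zero : Move.left.apply (0 : Ordinal.{u}) = 0 := by
  simp [Move.apply]

theorem left_apply_add_one (p : Ordinal.{u}) : Move.left.apply (p + 1) = p := by
  simp [Move.apply]

theorem left_apply_of_isSuccLimit {p : Ordinal.{u}} (hp : Order.IsSuccLimit p) :
    Move.left.apply p = 0 := by
  simp [Move.apply, hp.isSuccPrelimit]

theorem left_apply_add_one_le {p : Ordinal.{u}} (hp : p ≠ 0) : Move.left.apply p + 1 ≤ p := by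
  rcases Ordinal.zero_or_succ_or_isSuccLimit p with h | ⟨q, rfl⟩ | h
  · exact absurd h hp
  · exact (congrArg (· + 1) (left_apply_add_one q)).le
  · rw [left_apply_of_isSuccLimit h, zero_add]
    exact Order.one_le_iff_ne_zero.2 hp

theorem left_apply_lt {p : Ordinal.{u}} (hp : p ≠ 0) : Move.left.apply p < p :=
  Order.add_one_le_iff.1 (left_apply_add_one_le hp)

theorem left_apply_le (p : Ordinal.{u}) : Move.left.apply p ≤ p := by
  rcases eq_or_ne p 0 with rfl | hp
  · exact left_apply_zero.le
  · exact (left_apply_lt hp).le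

end Move

/-- The position of a head that starts at cell `m` and moves left for `b` steps. -/
noncomputable def retreat (m b : Ordinal.{u}) : Ordinal.{u} :=
  Ordinal.limitRecOn b m (fun _ p => Move.left.apply p) (fun _ _ _ => 0)

theorem retreat_zero (m : Ordinal.{u}) : retreat m 0 = m :=
  Ordinal.limitRecOn_zero ..

theorem retreat_add_one (m b : Ordinal.{u}) : retreat m (b + 1) = Move.left.apply (retreat m b) :=
  Ordinal.limitRecOn_add_one ..

theorem retreat_of_isSuccLimit (m : Ordinal.{u}) {b : Ordinal.{u}} (hb : Order.IsSuccLimit b) :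
    retreat m b = 0 :=
  Ordinal.limitRecOn_limit _ _ _ _ hb

theorem retreat_antitone (m : Ordinal.{u}) : Antitone (retreat m) := by
  intro b c hbc
  induction c using Ordinal.limitRecOn with
  | zero => exact nonpos_iff_eq_zero.1 hbc ▸ le_rfl
  | add_one c ih =>
    rcases hbc.eq_or_lt with rfl | hlt
    · exact le_rfl
    · exact (retreat_add_one m c).trans_le
        ((Move.left_apply_le _).trans (ih (Order.lt_add_one_iff.1 hlt)))
  | limit c hc ih => exact (retreat_of_isSuccLimit m hc).trans_le zero_le

theorem retreat_le (m b : Ordinal.{u}) : retreat m b ≤ m :=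
  (retreat_antitone m zero_le).trans (retreat_zero m).le

theorem retreat_one (m : Ordinal.{u}) : retreat m 1 = Move.left.apply m := by
  rw [← zero_add 1, retreat_add_one, retreat_zero]

theorem retreat_one_add_lt {m : Ordinal.{u}} (hm : m ≠ 0) (a : Ordinal.{u}) :
    retreat m (1 + a) < m :=
  (retreat_antitone m le_self_add).trans_lt ((retreat_one m).trans_lt (Move.left_apply_lt hm))

theorem retreat_eq_zero_of_le {m b c : Ordinal.{u}} (h : retreat m b = 0) (hbc : b ≤ c) :
    retreat m c = 0 :=
  nonpos_iff_eq_zero.1 (h ▸ retreat_antitone m hbc)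

theorem retreat_nat_add_le (m : Ordinal.{u}) (n : ℕ) : retreat m n = 0 ∨ retreat m n + n ≤ m := by
  induction n with
  | zero => right; simp [retreat_zero]
  | succ n ih =>
    rw [Nat.cast_succ, retreat_add_one]
    rcases ih with h | h
    · left; rw [h, Move.left_apply_zero]
    · rcases eq_or_ne (retreat m n) 0 with h0 | h0
      · left; rw [h0, Move.left_apply_zero]
      · right
        refine le_trans ?_ h
        -- Finite ordinals commute, which puts the new unit next to the position of the head, where
        -- the left move has lost it.
        have : (n : Ordinal.{u}) + 1 = 1 + n := by exact_mod_cast add_comm n 1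
        rw [this, ← add_assoc]
        exact add_le_add_left (Move.left_apply_add_one_le h0) _

/-- Otherwise the positions would form an infinite strictly decreasing sequence of ordinals. This is
why a retreating head is at 0 at every limit stage. -/
theorem exists_retreat_eq_zero (m : Ordinal.{u}) : ∃ n : ℕ, retreat m n = 0 := by
  by_contra! h
  have hanti : StrictAnti fun n : ℕ => retreat m n := strictAnti_nat_of_succ_lt fun n => by
    rw [Nat.cast_succ, retreat_add_one]
    exact Move.left_apply_lt (h n)
  exact not_strictAnti_of_wellFoundedLT _ hanti

/-- A finite `m` is used up by `m` left moves; for an infinite `m` the finitely many moves that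
suffice are fewer than `m`. -/
theorem retreat_self (m : Ordinal.{u}) : retreat m m = 0 := by
  rcases lt_or_ge m Ordinal.omega0 with h | h
  · obtain ⟨n, rfl⟩ := Ordinal.lt_omega0.1 h
    rcases retreat_nat_add_le (n : Ordinal.{u}) n with h | h
    · exact h
    · by_contra h0
      have h1 : 1 + (n : Ordinal.{u}) ≤ n :=
        (add_le_add_left (Order.one_le_iff_ne_zero.2 h0) _).trans h
      have : 1 + n ≤ n := by exact_mod_cast h1
      omega
  · obtain ⟨n, hn⟩ := exists_retreat_eq_zero m
    exact retreat_eq_zero_of_le hn ((Ordinal.natCast_lt_omega0 n).le.trans h)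

theorem retreat_one_add_eq_zero {m b : Ordinal.{u}} (h : m ≤ b) : retreat m (1 + b) = 0 :=
  retreat_eq_zero_of_le (retreat_self m) (h.trans le_add_self)

end KTM

/-! ### Successors and limits in the order ≺ -/

namespace Goedel

open KTM

/-- The successor of a pair in the order `≺`. -/
noncomputable def next (p : Ordinal.{u} × Ordinal.{u}) : Ordinal.{u} × Ordinal.{u} :=
  if p.1 < p.2 then if p.1 + 1 < p.2 then (p.1 + 1, p.2) else (p.2, 0)
  else if p.2 < p.1 then (p.1, p.2 + 1) else (0, p.1 + 1)

theorem next_of_add_one_lt {a m : Ordinal.{u}} (h : a + 1 < m) : next (a, m) = (a + 1, m) := by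
  have : a < m := (Order.lt_add_one_iff.2 le_rfl).trans h
  simp [next, this, h]

theorem next_of_add_one_eq (a : Ordinal.{u}) : next (a, a + 1) = (a + 1, 0) := by
  simp [next]

theorem next_of_lt {m b : Ordinal.{u}} (h : b < m) : next (m, b) = (m, b + 1) := by
  simp [next, h, h.not_gt]

theorem next_diag (m : Ordinal.{u}) : next (m, m) = (0, m + 1) := by
  simp [next]

theorem prec_next (p : Ordinal.{u} × Ordinal.{u}) : Prec p (next p) := by
  obtain ⟨a, b⟩ := p
  have h1 := Order.add_one_le_iff (x := a) (y := b)
  have h2 := Order.add_one_le_iff (x := b) (y := a)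
  have h3 : ∀ c : Ordinal.{u}, c < c + 1 := fun c => Order.lt_add_one_iff.2 le_rfl
  have h4 : ∀ c : Ordinal.{u}, 0 ≤ c := fun c => zero_le
  rw [prec_iff, next]
  grind

theorem not_prec_next {p q : Ordinal.{u} × Ordinal.{u}} (h : Prec p q) : ¬ Prec q (next p) := by
  obtain ⟨a, b⟩ := p
  obtain ⟨c, d⟩ := q
  have h1 := Order.add_one_le_iff (x := a) (y := b)
  have h2 := Order.add_one_le_iff (x := b) (y := a)
  have h3 : ∀ x : Ordinal.{u}, x < a + 1 ↔ x ≤ a := fun x => Order.lt_add_one_iff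
  have h5 : ∀ x : Ordinal.{u}, x < b + 1 ↔ x ≤ b := fun x => Order.lt_add_one_iff
  have ha : 0 ≤ a := zero_le
  have hb : 0 ≤ b := zero_le
  have hc : 0 ≤ c := zero_le
  have hd : 0 ≤ d := zero_le
  have ha' : 0 ≤ a + 1 := zero_le
  rw [prec_iff] at h ⊢
  rw [next]
  grind

/-- `next` gives the immediate ≺-successor: it lies later, and no pair lies strictly between. -/
theorem unpair_add_one (i : Ordinal.{u}) : unpair (i + 1) = next (unpair i) := by
  rcases trichotomous_of Prec (unpair (i + 1)) (next (unpair i)) with h | h | h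
  · exact absurd h (not_prec_next (prec_unpair.2 (Order.lt_add_one_iff.2 le_rfl)))
  · exact h
  · rw [← unpair_pair (next (unpair i)), prec_unpair, Order.lt_add_one_iff] at h
    have h' := prec_next (unpair i)
    rw [← unpair_pair (next (unpair i)), prec_unpair] at h'
    exact absurd h' h.not_gt

theorem unpair_zero : unpair (0 : Ordinal.{u}) = (0, 0) := by
  have := max_unpair_le (0 : Ordinal.{u})
  simpa [Prod.ext_iff] using this

theorem eventuallyBelow_of_prec {l : Ordinal.{u}} {P : Ordinal.{u} → Prop}
    (q : Ordinal.{u} × Ordinal.{u}) (hq : Prec q (unpair l))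
    (h : ∀ i, ¬ Prec (unpair i) q → Prec (unpair i) (unpair l) → P i) : EventuallyBelow l P := by
  refine ⟨pair q.1 q.2, ?_, fun i h₁ h₂ => h i ?_ (prec_unpair.2 h₂)⟩
  · rwa [← prec_unpair, unpair_pair]
  · rw [← unpair_pair q, prec_unpair]
    exact h₁.not_gt

/-- These are the pairs other than (0,0) that are not values of `next`. The first case joins (a,m)
and, for a = m, the turning point (m,0), since both are approached along the first row of m. -/
theorem unpair_limit_cases {l : Ordinal.{u}} (hl : Order.IsSuccLimit l) :
    (∃ m a, Order.IsSuccLimit a ∧ a ≤ m ∧ unpair l = if a < m then (a, m) else (m, 0)) ∨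
    (∃ m b, Order.IsSuccLimit b ∧ b ≤ m ∧ unpair l = (m, b)) ∨
    (∃ m, Order.IsSuccLimit m ∧ unpair l = (0, m)) := by
  have hnext : ∀ p, unpair l ≠ next p := by
    intro p hp
    rw [← unpair_pair p, ← unpair_add_one] at hp
    have := unpair_injective hp
    have hlt : pair p.1 p.2 < l := this ▸ Order.lt_add_one_iff.2 le_rfl
    exact (hl.add_one_lt hlt).ne' this
  have hzero : unpair l ≠ (0, 0) := by
    rw [← unpair_zero]
    exact fun h => hl.bot_lt.ne' (unpair_injective h)
  generalize unpair l = p at hnext hzero ⊢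
  obtain ⟨α, β⟩ := p
  rcases lt_or_ge α β with hlt | hle
  · rcases Ordinal.zero_or_succ_or_isSuccLimit α with rfl | ⟨α', rfl⟩ | h
    · rcases Ordinal.zero_or_succ_or_isSuccLimit β with rfl | ⟨β', rfl⟩ | h
      · exact absurd rfl hzero
      · exact absurd (next_diag β').symm (hnext _)
      · exact .inr (.inr ⟨β, h, rfl⟩)
    · exact absurd (next_of_add_one_lt hlt).symm (hnext _)
    · exact .inl ⟨β, α, h, hlt.le, by simp [hlt]⟩
  · rcases Ordinal.zero_or_succ_or_isSuccLimit β with rfl | ⟨β', rfl⟩ | h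
    · rcases Ordinal.zero_or_succ_or_isSuccLimit α with rfl | ⟨α', rfl⟩ | h
      · exact absurd rfl hzero
      · exact absurd (next_of_add_one_eq α').symm (hnext _)
      · exact .inl ⟨α, α, h, le_rfl, by simp⟩
    · exact absurd (next_of_lt (Order.add_one_le_iff.1 hle)).symm (hnext _)
    · exact .inr (.inl ⟨α, β, h, hle, rfl⟩)

/-! ### Enumeration of the pairs of ordinals by two heads

At time `i`, the pair is `unpair i = (α, β)`. Let `m = max α β`. While `α < β = m`, a head `A` is at
cell `α`, and moves right, and a head `B` moves left. While `β ≤ α = m`, the head `B` is at cell `β`,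
and moves right, and `A` moves left. -/

/-- The larger component of the pair with the number `i`. -/
noncomputable def diag (i : Ordinal.{u}) : Ordinal.{u} := max (unpair i).1 (unpair i).2

open Classical in
/-- Whether the pair with the number `i` is `(m, b)` with `0 < b ≤ m`. -/
noncomputable def phase (i : Ordinal.{u}) : Bool :=
  decide ((unpair i).2 ≤ (unpair i).1 ∧ 0 < (unpair i).2)

/-- The position of the head `A`. -/
noncomputable def headA (i : Ordinal.{u}) : Ordinal.{u} :=
  if (unpair i).1 < (unpair i).2 then (unpair i).1 else retreat (unpair i).1 (unpair i).2

/-- The position of the head `B`. -/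
noncomputable def headB (i : Ordinal.{u}) : Ordinal.{u} :=
  if (unpair i).1 < (unpair i).2 then retreat (unpair i).2 (1 + (unpair i).1) else (unpair i).2

open Classical in
/-- A tape on which the head `A` writes a `1` at every time before `i`. -/
noncomputable def unaryA (i c : Ordinal.{u}) : Bool :=
  decide (c < diag i) || (phase i && decide (c = diag i))

open Classical in
/-- A tape on which the head `B` writes a `1` at every time before `i`. -/
noncomputable def unaryB (i c : Ordinal.{u}) : Bool := decide (c < diag i)

/-- Whether the head `A` moves right at time `i`. -/
noncomputable def advancesA (i : Ordinal.{u}) : Bool := !phase i && unaryA i (headA i)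

section Values

variable {i a b m : Ordinal.{u}}

theorem diag_of_lt (h : unpair i = (a, m)) (hlt : a < m) : diag i = m := by
  simp [diag, h, hlt.le]

theorem phase_of_lt (h : unpair i = (a, m)) (hlt : a < m) : phase i = false := by
  simp [phase, h, hlt.not_ge]

theorem headA_of_lt (h : unpair i = (a, m)) (hlt : a < m) : headA i = a := by
  simp [headA, h, hlt]

/-- The offset 1 records where B starts its return: at (0, m + 1) it still stands on m, where the
previous row ended. For a limit maximum the same offset gives cell 0. -/
theorem headB_of_lt (h : unpair i = (a, m)) (hlt : a < m) : headB i = retreat m (1 + a) := by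
  simp [headB, h, hlt]

theorem diag_of_ge (h : unpair i = (m, b)) (hle : b ≤ m) : diag i = m := by
  simp [diag, h, hle]

theorem phase_of_ge (h : unpair i = (m, b)) (hle : b ≤ m) (hb : b ≠ 0) : phase i = true := by
  simp [phase, h, hle, pos_iff_ne_zero.2 hb]

/-- For a limit `m` the state at (m,0) is inherited from the first row, so the phase cannot have
changed yet. The turn is recognised by the unmarked cell under A instead. -/
theorem phase_of_zero (h : unpair i = (m, 0)) : phase i = false := by
  simp [phase, h]

theorem headA_of_ge (h : unpair i = (m, b)) (hle : b ≤ m) : headA i = retreat m b := by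
  simp [headA, h, hle.not_gt]

theorem headB_of_ge (h : unpair i = (m, b)) (hle : b ≤ m) : headB i = b := by
  simp [headB, h, hle.not_gt]

end Values

theorem unpair_cases (i : Ordinal.{u}) :
    (∃ a m, a < m ∧ unpair i = (a, m)) ∨ ∃ m b, b ≤ m ∧ unpair i = (m, b) := by
  rcases lt_or_ge (unpair i).1 (unpair i).2 with h | h
  · exact .inl ⟨_, _, h, rfl⟩
  · exact .inr ⟨_, _, h, rfl⟩

theorem advancesA_of_lt {i a m : Ordinal.{u}} (h : unpair i = (a, m)) (hlt : a < m) :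
    advancesA i = true := by
  simp [advancesA, phase_of_lt h hlt, unaryA, headA_of_lt h hlt, diag_of_lt h hlt, hlt]

theorem advancesA_of_ge {i b m : Ordinal.{u}} (h : unpair i = (m, b)) (hle : b ≤ m) :
    advancesA i = false := by
  rcases eq_or_ne b 0 with rfl | hb
  · simp [advancesA, phase_of_zero h, unaryA, headA_of_ge h hle, diag_of_ge h hle, retreat_zero]
  · simp [advancesA, phase_of_ge h hle hb]

theorem headA_le (i : Ordinal.{u}) : headA i ≤ diag i := by
  rcases unpair_cases i with ⟨a, m, hlt, h⟩ | ⟨m, b, hle, h⟩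
  · rw [headA_of_lt h hlt, diag_of_lt h hlt]
    exact hlt.le
  · rw [headA_of_ge h hle, diag_of_ge h hle]
    exact retreat_le _ _

theorem headB_le (i : Ordinal.{u}) : headB i ≤ diag i := by
  rcases unpair_cases i with ⟨a, m, hlt, h⟩ | ⟨m, b, hle, h⟩
  · rw [headB_of_lt h hlt, diag_of_lt h hlt]
    exact retreat_le _ _
  · rw [headB_of_ge h hle, diag_of_ge h hle]
    exact hle

/-- All cells below the maximum are marked and A never passes the maximum. -/
theorem headA_eq_diag {i : Ordinal.{u}} (h : unaryA i (headA i) = false) : headA i = diag i := by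
  refine le_antisymm (headA_le i) (not_lt.1 fun hlt => ?_)
  simp [unaryA, hlt] at h

theorem headB_eq_diag {i : Ordinal.{u}} (h : unaryB i (headB i) = false) : headB i = diag i := by
  refine le_antisymm (headB_le i) (not_lt.1 fun hlt => ?_)
  simp [unaryB, hlt] at h

/-- The form in which the machines see the pair: one component is the maximum, the other the
position of the advancing head. -/
theorem unpair_eq (i : Ordinal.{u}) :
    unpair i = if advancesA i then (headA i, diag i) else (diag i, headB i) := by
  rcases unpair_cases i with ⟨a, m, hlt, h⟩ | ⟨m, b, hle, h⟩
  · simp [advancesA_of_lt h hlt, headA_of_lt h hlt, diag_of_lt h hlt, h]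
  · simp [advancesA_of_ge h hle, headB_of_ge h hle, diag_of_ge h hle, h]

/-- The cell under the head `B` contains a `1` while the head `A` moves right. -/
theorem unaryB_of_advancesA {i : Ordinal.{u}} (hi : advancesA i = true) :
    unaryB i (headB i) = true := by
  rcases unpair_cases i with ⟨a, m, hlt, h⟩ | ⟨m, b, hle, h⟩
  · simp [unaryB, headB_of_lt h hlt, diag_of_lt h hlt, retreat_one_add_lt hlt.ne_bot]
  · simp [advancesA_of_ge h hle] at hi

theorem phase_add_one (i : Ordinal.{u}) :
    phase (i + 1) = (!advancesA i && unaryB i (headB i)) := by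
  rcases unpair_cases i with ⟨a, m, hlt, h⟩ | ⟨m, b, hle, h⟩
  · rw [advancesA_of_lt h hlt]
    rcases (Order.add_one_le_of_lt hlt).lt_or_eq with hlt' | rfl
    · have h' := unpair_add_one i
      rw [h, next_of_add_one_lt hlt'] at h'
      simp [phase_of_lt h' hlt']
    · have h' := unpair_add_one i
      rw [h, next_of_add_one_eq] at h'
      simp [phase_of_zero h']
  · rw [advancesA_of_ge h hle]
    rcases hle.lt_or_eq with hlt | rfl
    · have h' := unpair_add_one i
      rw [h, next_of_lt hlt] at h'
      simp [phase_of_ge h' (Order.add_one_le_of_lt hlt), unaryB, headB_of_ge h hle,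
        diag_of_ge h hle, hlt]
    · have h' := unpair_add_one i
      rw [h, next_diag] at h'
      simp [phase_of_lt h', unaryB, headB_of_ge h hle, diag_of_ge h hle]

theorem headA_add_one (i : Ordinal.{u}) :
    headA (i + 1) = if advancesA i then headA i + 1 else Move.left.apply (headA i) := by
  rcases unpair_cases i with ⟨a, m, hlt, h⟩ | ⟨m, b, hle, h⟩
  · rw [advancesA_of_lt h hlt]
    rcases (Order.add_one_le_of_lt hlt).lt_or_eq with hlt' | rfl
    · have h' := unpair_add_one i
      rw [h, next_of_add_one_lt hlt'] at h'
      simp [headA_of_lt h' hlt', headA_of_lt h hlt]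
    · have h' := unpair_add_one i
      rw [h, next_of_add_one_eq] at h'
      simp [headA_of_ge h' zero_le, headA_of_lt h hlt, retreat_zero]
  · rw [advancesA_of_ge h hle]
    rcases hle.lt_or_eq with hlt | rfl
    · have h' := unpair_add_one i
      rw [h, next_of_lt hlt] at h'
      simp [headA_of_ge h' (Order.add_one_le_of_lt hlt), headA_of_ge h hle, retreat_add_one]
    · have h' := unpair_add_one i
      rw [h, next_diag] at h'
      simp [headA_of_lt h', headA_of_ge h hle, retreat_self, Move.left_apply_zero]

theorem headB_add_one (i : Ordinal.{u}) :
    headB (i + 1) = if advancesA i then Move.left.apply (headB i)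
      else if unaryB i (headB i) then headB i + 1 else headB i := by
  rcases unpair_cases i with ⟨a, m, hlt, h⟩ | ⟨m, b, hle, h⟩
  · rw [advancesA_of_lt h hlt]
    rcases (Order.add_one_le_of_lt hlt).lt_or_eq with hlt' | rfl
    · have h' := unpair_add_one i
      rw [h, next_of_add_one_lt hlt'] at h'
      simp [headB_of_lt h' hlt', headB_of_lt h hlt, ← retreat_add_one, add_assoc]
    · have h' := unpair_add_one i
      rw [h, next_of_add_one_eq] at h'
      have := retreat_one_add_eq_zero (le_refl (a + 1))
      simp [headB_of_ge h' zero_le, headB_of_lt h hlt, ← retreat_add_one, add_assoc, this]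
  · rw [advancesA_of_ge h hle]
    rcases hle.lt_or_eq with hlt | rfl
    · have h' := unpair_add_one i
      rw [h, next_of_lt hlt] at h'
      simp [headB_of_ge h' (Order.add_one_le_of_lt hlt), headB_of_ge h hle, unaryB,
        diag_of_ge h hle, hlt]
    · have h' := unpair_add_one i
      rw [h, next_diag] at h'
      simp [headB_of_lt h', headB_of_ge h hle, unaryB, diag_of_ge h hle, retreat_one,
        Move.left_apply_add_one]

theorem diag_add_one (i : Ordinal.{u}) :
    diag (i + 1) = if unaryB i (headB i) then diag i else diag i + 1 := by
  rcases unpair_cases i with ⟨a, m, hlt, h⟩ | ⟨m, b, hle, h⟩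
  · rw [unaryB_of_advancesA (advancesA_of_lt h hlt)]
    rcases (Order.add_one_le_of_lt hlt).lt_or_eq with hlt' | rfl
    · have h' := unpair_add_one i
      rw [h, next_of_add_one_lt hlt'] at h'
      simp [diag_of_lt h' hlt', diag_of_lt h hlt]
    · have h' := unpair_add_one i
      rw [h, next_of_add_one_eq] at h'
      simp [diag_of_ge h' zero_le, diag_of_lt h hlt]
  · rcases hle.lt_or_eq with hlt | rfl
    · have h' := unpair_add_one i
      rw [h, next_of_lt hlt] at h'
      simp [diag_of_ge h' (Order.add_one_le_of_lt hlt), headB_of_ge h hle, unaryB,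
        diag_of_ge h hle, hlt]
    · have h' := unpair_add_one i
      rw [h, next_diag] at h'
      simp [diag_of_lt h', headB_of_ge h hle, unaryB, diag_of_ge h hle]

theorem unaryB_add_one (i : Ordinal.{u}) :
    unaryB (i + 1) = Function.update (unaryB i) (headB i) true := by
  funext c
  rcases hb : unaryB i (headB i) with _ | _
  · have hd := headB_eq_diag hb
    have hd' : diag (i + 1) = diag i + 1 := by rw [diag_add_one, hb]; rfl
    rcases eq_or_ne c (diag i) with rfl | hc
    · simp [unaryB, hd', hd]
    · rw [hd, Function.update_of_ne hc]
      simp [unaryB, hd', Order.lt_add_one_iff, hc.le_iff_lt]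
  · have hd' : diag (i + 1) = diag i := by rw [diag_add_one, hb]; rfl
    rw [← hb, Function.update_eq_self]
    simp [unaryB, hd']

theorem unaryA_add_one (i : Ordinal.{u}) :
    unaryA (i + 1) = Function.update (unaryA i) (headA i) true := by
  funext c
  rcases unpair_cases i with ⟨a, m, hlt, h⟩ | ⟨m, b, hle, h⟩
  · have hA := advancesA_of_lt h hlt
    have hu : unaryA i (headA i) = true := by
      simp [unaryA, headA_of_lt h hlt, diag_of_lt h hlt, hlt]
    rw [← hu, Function.update_eq_self]
    simp [unaryA, diag_add_one, unaryB_of_advancesA hA, phase_add_one, hA, phase_of_lt h hlt]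
  · have hA := advancesA_of_ge h hle
    -- After a pair of the second row the marks of A include the old maximum: either the maximum has
    -- grown past it, or the phase is now true.
    have key : unaryA (i + 1) c = decide (c ≤ diag i) := by
      rcases hb : unaryB i (headB i) with _ | _
      · simp [unaryA, diag_add_one, hb, phase_add_one, hA, Order.lt_add_one_iff]
      · simp [unaryA, diag_add_one, hb, phase_add_one, hA, le_iff_lt_or_eq]
    rw [key]
    have hd := diag_of_ge h hle
    rcases eq_or_ne b 0 with rfl | hb
    · rw [headA_of_ge h hle, retreat_zero, ← hd]
      rcases eq_or_ne c (diag i) with rfl | hc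
      · simp
      · rw [Function.update_of_ne hc]
        simp [unaryA, phase_of_zero h, hc.le_iff_lt]
    · have hu : ∀ c, unaryA i c = decide (c ≤ diag i) := fun c => by
        simp [unaryA, phase_of_ge h hle hb, le_iff_lt_or_eq]
      have hu' : unaryA i (headA i) = true := by simp [hu, headA_le]
      rw [← hu', Function.update_eq_self, hu]

theorem diag_zero : diag (0 : Ordinal.{u}) = 0 := by simp [diag, unpair_zero]

theorem phase_zero : phase (0 : Ordinal.{u}) = false := by simp [phase, unpair_zero]

theorem headA_zero : headA (0 : Ordinal.{u}) = 0 := by simp [headA, unpair_zero, retreat_zero]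

theorem headB_zero : headB (0 : Ordinal.{u}) = 0 := by simp [headB, unpair_zero]

theorem unaryA_zero : unaryA (0 : Ordinal.{u}) = fun _ => false := by
  funext c; simp [unaryA, diag_zero, phase_zero]

theorem unaryB_zero : unaryB (0 : Ordinal.{u}) = fun _ => false := by
  funext c; simp [unaryB, diag_zero]

end Goedel

/-! ### Limit stages of the enumeration -/

namespace KTM

theorem EventuallyBelow.frequently {l : Ordinal.{u}} {P : Ordinal.{u} → Prop}
    (h : EventuallyBelow l P) : FrequentlyBelow l P := by
  obtain ⟨a, ha, H⟩ := h
  intro b hb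
  exact ⟨max a b, le_max_right _ _, max_lt ha hb, H _ (le_max_left _ _) (max_lt ha hb)⟩

theorem IsLiminfBelow.of_eventually_zero {l : Ordinal.{u}} {p : Ordinal.{u} → Prop}
    {f : Ordinal.{u} → Ordinal.{u}} (h : FrequentlyBelow l fun i => p i ∧ f i = 0) :
    IsLiminfBelow l p f 0 :=
  ⟨fun _ ha => absurd ha not_lt_zero, h.mono fun _ _ hi => ⟨hi.1, hi.2.le⟩⟩

end KTM

namespace Goedel

open KTM

/-- From (x + 1, m) on, only pairs of the first row of `m` remain before the limit. -/
theorem eventuallyBelow_of_lt {l a m : Ordinal.{u}} (ha : Order.IsSuccLimit a) (ham : a ≤ m)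
    (h : unpair l = if a < m then (a, m) else (m, 0)) {x : Ordinal.{u}} (hx : x < a) :
    EventuallyBelow l fun i => ∃ b, x < b ∧ b < a ∧ b < m ∧ unpair i = (b, m) := by
  have hx' := ha.add_one_lt hx
  have hm0 : 0 < m := ha.bot_lt.trans_le ham
  refine eventuallyBelow_of_prec (x + 1, m) ?_ fun i h₁ h₂ => ?_
  · rw [h, prec_iff]
    split_ifs with hlt
    · simp [hx', ham, (hx'.trans_le ham).le]
    · simp [(hx'.trans_le ham).le, hx'.trans_le ham]
  · generalize unpair i = q at h₁ h₂ ⊢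
    obtain ⟨c, d⟩ := q
    have hxm := hx'.trans_le ham
    have hxc := Order.add_one_le_iff (x := x) (y := c)
    have hd : 0 ≤ d := zero_le
    rw [h, prec_iff] at h₂
    rw [prec_iff] at h₁
    simp only [max_eq_right hxm.le] at h₁
    split_ifs at h₂ with hlt
    · simp only [max_eq_right ham] at h₂
      have : max c d = m ∧ x + 1 ≤ c ∧ c < a ∧ d = m := by grind
      exact ⟨c, hxc.1 this.2.1, this.2.2.1, this.2.2.1.trans hlt, by rw [this.2.2.2]⟩
    · simp only [max_eq_left hm0.le] at h₂
      have : max c d = m ∧ x + 1 ≤ c ∧ c < m ∧ d = m := by grind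
      exact ⟨c, hxc.1 this.2.1, by order, this.2.2.1, by rw [this.2.2.2]⟩

theorem eventuallyBelow_of_ge {l b m : Ordinal.{u}} (hb : Order.IsSuccLimit b) (hbm : b ≤ m)
    (h : unpair l = (m, b)) {x : Ordinal.{u}} (hx : x < b) :
    EventuallyBelow l fun i => ∃ c, x < c ∧ c < b ∧ unpair i = (m, c) := by
  have hx' := hb.add_one_lt hx
  refine eventuallyBelow_of_prec (m, x + 1) ?_ fun i h₁ h₂ => ?_
  · rw [h, prec_iff]
    simp [hbm, hx', (hx'.trans_le hbm).le]
  · generalize unpair i = q at h₁ h₂ ⊢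
    obtain ⟨c, d⟩ := q
    have hxm := hx'.trans_le hbm
    have hxc := Order.add_one_le_iff (x := x) (y := d)
    rw [h, prec_iff] at h₂
    rw [prec_iff] at h₁
    simp only [max_eq_left hxm.le] at h₁
    simp only [max_eq_left hbm] at h₂
    have : c = m ∧ x + 1 ≤ d ∧ d < b := by grind
    exact ⟨d, hxc.1 this.2.1, this.2.2, by rw [this.1]⟩

theorem eventuallyBelow_diag {l m : Ordinal.{u}} (hm : Order.IsSuccLimit m)
    (h : unpair l = (0, m)) {x : Ordinal.{u}} (hx : x < m) :
    EventuallyBelow l fun i => x < diag i ∧ diag i < m := by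
  have hx' := hm.add_one_lt hx
  refine eventuallyBelow_of_prec (0, x + 1) ?_ fun i h₁ h₂ => ?_
  · rw [h, prec_iff]
    simp [hx']
  · rw [h, prec_iff] at h₂
    rw [prec_iff] at h₁
    change ¬ (diag i < _ ∨ diag i = _ ∧ _) at h₁
    change (diag i < _ ∨ diag i = _ ∧ _) at h₂
    have hxd := Order.add_one_le_iff (x := x) (y := diag i)
    have h0 : 0 ≤ (unpair i).1 := zero_le
    have hd : max (unpair i).1 (unpair i).2 = diag i := rfl
    have hm0 : 0 < m := hm.bot_lt
    have h0' : 0 ≤ (unpair i).2 := zero_le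
    simp only [max_eq_right (zero_le : 0 ≤ m)] at h₂
    simp only [max_eq_right (zero_le : 0 ≤ x + 1)] at h₁
    grind

/-- The limit behaviour of the enumeration of the pairs. -/
structure IsScanLimit (l : Ordinal.{u}) : Prop where
  phase : EventuallyBelow l fun i => phase l = true → phase i = true
  headA : IsLiminfBelow l (fun i => Goedel.phase i = Goedel.phase l) headA (headA l)
  headB : IsLiminfBelow l (fun i => Goedel.phase i = Goedel.phase l) headB (headB l)
  unaryA : ∀ c, EventuallyBelow l fun i => unaryA i c = unaryA l c
  unaryB : ∀ c, EventuallyBelow l fun i => unaryB i c = unaryB l c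
  diag : ∀ a < diag l, EventuallyBelow l fun i => a < Goedel.diag i

/-- Along the first row A converges to `a`, while B has come back to 0 and stays there. -/
theorem isScanLimit_of_lt {l a m : Ordinal.{u}} (ha : Order.IsSuccLimit a) (ham : a ≤ m)
    (h : unpair l = if a < m then (a, m) else (m, 0)) : IsScanLimit l := by
  have ev := fun x hx => eventuallyBelow_of_lt ha ham h (x := x) hx
  have hm0 : 0 < m := ha.bot_lt.trans_le ham
  obtain ⟨hd, hp, hA, hB⟩ :
      diag l = m ∧ phase l = false ∧ headA l = a ∧ headB l = 0 := by
    split_ifs at h with hlt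
    · refine ⟨diag_of_lt h hlt, phase_of_lt h hlt, headA_of_lt h hlt, ?_⟩
      rw [headB_of_lt h hlt, retreat_of_isSuccLimit _ (Ordinal.isSuccLimit_add _ ha)]
    · obtain rfl : a = m := by order
      refine ⟨diag_of_ge h zero_le, phase_of_zero h, ?_, headB_of_ge h zero_le⟩
      rw [headA_of_ge h zero_le, retreat_zero]
  -- B is back before the limit: finitely many left moves suffice and `a ≥ ω`; if `a = m`, the first
  -- move already leads from a limit cell to 0.
  have hret : ∃ x < a, ∀ c, x < c → retreat m (1 + c) = 0 := by
    by_cases hlt : a < m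
    · obtain ⟨n, hn⟩ := exists_retreat_eq_zero m
      exact ⟨n, (Ordinal.natCast_lt_omega0 n).trans_le (Ordinal.omega0_le_of_isSuccLimit ha),
        fun c hc => retreat_eq_zero_of_le hn (hc.le.trans le_add_self)⟩
    · obtain rfl : a = m := by order
      refine ⟨0, ha.bot_lt, fun c _ => ?_⟩
      refine retreat_eq_zero_of_le ?_ (le_self_add : 1 ≤ 1 + c)
      rw [retreat_one, Move.left_apply_of_isSuccLimit ha]
  refine ⟨?_, ⟨fun x hx => ?_, ?_⟩, ?_, fun c => ?_, fun c => ?_, fun x hx => ?_⟩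
  · simp only [hp]
    exact .of_forall (pos_iff_ne_zero.2 fun h0 => by
      subst h0; rw [diag_zero] at hd; exact hm0.ne hd) (by simp)
  · rw [hA] at hx
    refine (ev x hx).mono fun i _ ⟨b, h₁, h₂, h₃, h₄⟩ _ => ?_
    rwa [headA_of_lt h₄ h₃]
  · refine (ev 0 ha.bot_lt).frequently.mono fun i _ ⟨b, h₁, h₂, h₃, h₄⟩ => ?_
    rw [headA_of_lt h₄ h₃, hp, phase_of_lt h₄ h₃, hA]
    exact ⟨rfl, h₂.le⟩
  · obtain ⟨x, hx, hret⟩ := hret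
    rw [hB]
    refine .of_eventually_zero ((ev x hx).frequently.mono fun i _ ⟨b, h₁, h₂, h₃, h₄⟩ => ?_)
    rw [headB_of_lt h₄ h₃, hp, phase_of_lt h₄ h₃]
    exact ⟨rfl, hret b h₁⟩
  · refine (ev 0 ha.bot_lt).mono fun i _ ⟨b, h₁, h₂, h₃, h₄⟩ => ?_
    simp [Goedel.unaryA, hp, hd, phase_of_lt h₄ h₃, diag_of_lt h₄ h₃]
  · refine (ev 0 ha.bot_lt).mono fun i _ ⟨b, h₁, h₂, h₃, h₄⟩ => ?_
    simp [Goedel.unaryB, hd, diag_of_lt h₄ h₃]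
  · refine (ev 0 ha.bot_lt).mono fun i _ ⟨b, h₁, h₂, h₃, h₄⟩ => ?_
    rwa [diag_of_lt h₄ h₃, ← hd]

theorem isScanLimit_of_ge {l b m : Ordinal.{u}} (hb : Order.IsSuccLimit b) (hbm : b ≤ m)
    (h : unpair l = (m, b)) : IsScanLimit l := by
  have ev : ∀ x < b, EventuallyBelow l fun i =>
      ∃ c, x < c ∧ c ≤ b ∧ c ≤ m ∧ c ≠ 0 ∧ unpair i = (m, c) := fun x hx =>
    (eventuallyBelow_of_ge hb hbm h hx).mono fun i _ ⟨c, h₁, h₂, h₃⟩ =>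
      ⟨c, h₁, h₂.le, h₂.le.trans hbm, h₁.ne_bot, h₃⟩
  have hd := diag_of_ge h hbm
  have hp := phase_of_ge h hbm hb.ne_bot
  have hA := headA_of_ge h hbm
  rw [retreat_of_isSuccLimit _ hb] at hA
  have hB := headB_of_ge h hbm
  obtain ⟨n, hn⟩ := exists_retreat_eq_zero m
  have hnb : n < b := (Ordinal.natCast_lt_omega0 n).trans_le (Ordinal.omega0_le_of_isSuccLimit hb)
  refine ⟨?_, ?_, ⟨fun x hx => ?_, ?_⟩, fun c => ?_, fun c => ?_, fun x hx => ?_⟩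
  · exact (ev 0 hb.bot_lt).mono fun i _ ⟨c, h₁, h₂, h₃, h₄, h₅⟩ _ => phase_of_ge h₅ h₃ h₄
  · rw [hA]
    refine .of_eventually_zero ((ev n hnb).frequently.mono fun i _ ⟨c, h₁, h₂, h₃, h₄, h₅⟩ => ?_)
    rw [headA_of_ge h₅ h₃, hp, phase_of_ge h₅ h₃ h₄]
    exact ⟨rfl, retreat_eq_zero_of_le hn h₁.le⟩
  · rw [hB] at hx
    refine (ev x hx).mono fun i _ ⟨c, h₁, h₂, h₃, h₄, h₅⟩ _ => ?_
    rwa [headB_of_ge h₅ h₃]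
  · refine (ev 0 hb.bot_lt).frequently.mono fun i _ ⟨c, h₁, h₂, h₃, h₄, h₅⟩ => ?_
    rw [headB_of_ge h₅ h₃, hp, phase_of_ge h₅ h₃ h₄, hB]
    exact ⟨rfl, h₂⟩
  · refine (ev 0 hb.bot_lt).mono fun i _ ⟨c, h₁, h₂, h₃, h₄, h₅⟩ => ?_
    simp [Goedel.unaryA, hp, hd, phase_of_ge h₅ h₃ h₄, diag_of_ge h₅ h₃]
  · refine (ev 0 hb.bot_lt).mono fun i _ ⟨c, h₁, h₂, h₃, h₄, h₅⟩ => ?_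
    simp [Goedel.unaryB, hd, diag_of_ge h₅ h₃]
  · refine (ev 0 hb.bot_lt).mono fun i _ ⟨c, h₁, h₂, h₃, h₄, h₅⟩ => ?_
    rwa [diag_of_ge h₅ h₃, ← hd]

/-- Whole rows pass cofinally often below the limit. In the phase `false`, A is at 0 at the pairs
(0,x) and B at the pairs (x,0), so both inferior limits are 0 although neither head converges. -/
theorem isScanLimit_of_diag {l m : Ordinal.{u}} (hm : Order.IsSuccLimit m)
    (h : unpair l = (0, m)) : IsScanLimit l := by
  have ev := fun x hx => eventuallyBelow_diag hm h (x := x) hx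
  have hm0 : 0 < m := hm.bot_lt
  have hd := diag_of_lt h hm0
  have hp := phase_of_lt h hm0
  have hA := headA_of_lt h hm0
  have hB := headB_of_lt h hm0
  rw [add_zero, retreat_one, Move.left_apply_of_isSuccLimit hm] at hB
  have hpair : ∀ q : Ordinal.{u} × Ordinal.{u}, ∀ i < l, diag i < max q.1 q.2 →
      max q.1 q.2 < m → i ≤ pair q.1 q.2 ∧ pair q.1 q.2 < l := by
    intro q i hi h₁ h₂
    refine ⟨le_of_lt ?_, ?_⟩
    · rw [← prec_unpair, unpair_pair, prec_iff]
      exact .inl h₁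
    · rw [← prec_unpair, unpair_pair, prec_iff, h]
      exact .inl (by simpa using h₂)
  have hdiag : ∀ i < l, diag i ≤ m := fun i hi => hd ▸ max_unpair_mono hi.le
  -- A prescribed kind of pair `f x` with maximum x recurs cofinally: after any late time, take x to
  -- be the current maximum plus one, which is still below the limit `m`.
  have hfr : ∀ f : Ordinal.{u} → Ordinal.{u} × Ordinal.{u}, (∀ x, max (f x).1 (f x).2 = x) →
      ∀ P : Ordinal.{u} → Prop, (∀ i x, 0 < x → unpair i = f x → P i) → FrequentlyBelow l P := by
    intro f hf P hP a ha
    obtain ⟨a', ha', hEv⟩ := ev 0 hm0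
    have hlt := (hEv (max a a') (le_max_right _ _) (max_lt ha ha')).2
    have := hpair (f (diag (max a a') + 1)) (max a a') (max_lt ha ha')
      (by rw [hf]; exact Order.lt_add_one_iff.2 le_rfl) (by rw [hf]; exact hm.add_one_lt hlt)
    exact ⟨_, (le_max_left _ _).trans this.1, this.2, hP _ (diag (max a a') + 1)
      (by simp) (unpair_pair _)⟩
  refine ⟨?_, ?_, ?_, fun c => ?_, fun c => ?_, fun x hx => ?_⟩
  · simp only [hp]
    exact (ev 0 hm0).mono (by simp)
  · rw [hA]
    refine .of_eventually_zero (hfr (fun x => (0, x)) (by simp) _ fun i x hx hi => ?_)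
    rw [headA_of_lt hi hx, hp, phase_of_lt hi hx]
    exact ⟨rfl, rfl⟩
  · rw [hB]
    refine .of_eventually_zero (hfr (fun x => (x, 0)) (by simp) _ fun i x hx hi => ?_)
    rw [headB_of_ge hi zero_le, hp, phase_of_zero hi]
    exact ⟨rfl, rfl⟩
  · rcases lt_or_ge c m with hc | hc
    · refine (ev c hc).mono fun i _ hi => ?_
      simp [Goedel.unaryA, hd, hi.1, hc]
    · refine (ev 0 hm0).mono fun i _ hi => ?_
      simp [Goedel.unaryA, hd, hp, hc.not_gt, (hi.2.trans_le hc).not_gt, (hi.2.trans_le hc).ne']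
  · rcases lt_or_ge c m with hc | hc
    · refine (ev c hc).mono fun i _ hi => ?_
      simp [Goedel.unaryB, hd, hi.1, hc]
    · refine (ev 0 hm0).mono fun i _ hi => ?_
      simp [Goedel.unaryB, hd, hc.not_gt, (hi.2.trans_le hc).le]
  · exact (ev x (hd ▸ hx)).mono fun i _ hi => hi.1

theorem isScanLimit {l : Ordinal.{u}} (hl : Order.IsSuccLimit l) : IsScanLimit l := by
  rcases unpair_limit_cases hl with ⟨m, a, ha, ham, h⟩ | ⟨m, b, hb, hbm, h⟩ | ⟨m, hm, h⟩
  · exact isScanLimit_of_lt ha ham h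
  · exact isScanLimit_of_ge hb hbm h
  · exact isScanLimit_of_diag hm h

end Goedel

namespace KTM

/-- Left multiplication by 2 is continuous: `a < 2 * d` amounts to `a / 2 < d`. -/
theorem _root_.Goedel.IsScanLimit.two_mul_diag {l : Ordinal.{u}} (h : Goedel.IsScanLimit l) :
    IsLiminfBelow l (fun i => Goedel.phase i = Goedel.phase l) (fun i => 2 * Goedel.diag i)
      (2 * Goedel.diag l) where
  eventually a ha := by
    have h2 : (2 : Ordinal.{u}) ≠ 0 := two_ne_zero
    refine (h.diag (a / 2) ((Ordinal.lt_mul_iff_div_lt h2).1 ha)).mono fun i _ hi _ => ?_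
    exact (Ordinal.lt_mul_iff_div_lt h2).2 hi
  frequently := h.headA.frequently.mono fun _ hi hp =>
    ⟨hp.1, mul_le_mul_right (Goedel.max_unpair_mono hi.le) _⟩

theorem Machine.step_of_trans_eq (M : Machine) {κ : Cardinal.{u}} {x : Cantor κ}
    {c : Config.{u} M.numStates M.numTapes} {a : Action M.numStates M.numTapes}
    (h : M.trans c.state (readInput x c.inputHead) (fun i => c.tape i (c.head i)) = a) :
    M.step x c =
      { state := a.state
        inputHead := a.inputMove.apply c.inputHead
        head := fun i => (a.move i).apply (c.head i)
        tape := fun i => Function.update (c.tape i) (c.head i) (a.write i)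
        outputHead := if a.output.isSome then c.outputHead + 1 else c.outputHead
        outputTape :=
          match a.output with
          | some b => Function.update c.outputTape c.outputHead b
          | none => c.outputTape } := by
  subst h
  rfl

/-! ### A machine that computes the Gödel pairing function -/

namespace PairMachine

/-- The first step for a pair: in the phase `p`, read the input at an even place. -/
def probe (p : Bool) (x : Bool) (r : Fin 4 → Bool) : Action 6 4 where
  state := match p, x with
    | false, false => 2
    | false, true => 3
    | true, false => 4
    | true, true => 5
  inputMove := .right
  write := r
  move := fun _ => .stay
  output := none

/-- The second step for a pair: in the phase `p`, with the symbols `x` and `y` from the input, compare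
the pair with the pair in the input, and proceed to the next pair. -/
def compare (p x y a s b t : Bool) : Action 6 4 where
  state := if (if !p && a then (if a then s else x) && y else x && if b then t else y) then 6
    else if !p && a then 0 else if b then 1 else 0
  inputMove := if b then .left else .right
  write := ![true, if a then s else x, true, if b then t else y]
  move := if !p && a then ![.right, .right, .left, .left]
    else if b then ![.left, .left, .right, .right] else ![.left, .left, .stay, .stay]
  output := some (if !p && a then (if a then s else x) && y else x && if b then t else y)

/-- Append a `0` to the output. -/
def final (r : Fin 4 → Bool) : Action 6 4 := ⟨6, .stay, r, fun _ => .stay, some false⟩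

/-- The transition table. -/
def trans : Fin 7 → Bool → (Fin 4 → Bool) → Action 6 4 :=
  ![probe false, probe true,
    fun y r => compare false false y (r 0) (r 1) (r 2) (r 3),
    fun y r => compare false true y (r 0) (r 1) (r 2) (r 3),
    fun y r => compare true false y (r 0) (r 1) (r 2) (r 3),
    fun y r => compare true true y (r 0) (r 1) (r 2) (r 3),
    fun _ r => final r]

/-- The machine. The heads on the scratch tapes `0` and `1` move like the head `A`, and those on the
tapes `2` and `3` like the head `B` of the enumeration of the pairs. -/
abbrev machine : Machine := ⟨6, 4, trans⟩

/-- The configuration of the machine at time `2 * i`, on input `(α, β)`. -/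
noncomputable def config (α β i : Ordinal.{u}) : Config.{u} 6 4 where
  state := if Goedel.phase i then 1 else 0
  inputHead := 2 * Goedel.diag i
  head := ![Goedel.headA i, Goedel.headA i, Goedel.headB i, Goedel.headB i]
  tape := ![Goedel.unaryA i, fun c => Goedel.unaryA i c && decide (c = α),
    Goedel.unaryB i, fun c => Goedel.unaryB i c && decide (c = β)]
  outputHead := i
  outputTape := fun _ => false

/-- The configuration of the machine at time `2 * i + 1`. -/
noncomputable def midConfig (α β i : Ordinal.{u}) (b : Bool) : Config.{u} 6 4 :=
  { config α β i with
    state := match Goedel.phase i, b with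
      | false, false => 2
      | false, true => 3
      | true, false => 4
      | true, true => 5
    inputHead := 2 * Goedel.diag i + 1 }

variable {κ : Cardinal.{u}}

theorem step_config (x : Cantor κ) (α β i : Ordinal.{u}) :
    machine.step x (config α β i) = midConfig α β i (readInput x (2 * Goedel.diag i)) := by
  have h : machine.trans (config α β i).state = probe (Goedel.phase i) := by
    simp only [config]
    cases Goedel.phase i <;> rfl
  rw [machine.step_of_trans_eq (congrFun (congrFun h _) _)]
  simp only [probe, Function.update_eq_self]
  rfl

theorem step_midConfig {x : Cantor κ} {α β i : Ordinal.{u}}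
    (hβ : readInput x (2 * Goedel.diag i + 1) = decide (Goedel.diag i = β)) :
    machine.step x (midConfig α β i (decide (Goedel.diag i = α))) =
      { config α β (i + 1) with
        state := if Goedel.unpair i = (α, β) then 6 else if Goedel.phase (i + 1) then 1 else 0
        outputTape := Function.update (fun _ => false) i (decide (Goedel.unpair i = (α, β))) } := by
  set a := Goedel.unaryA i (Goedel.headA i) with ha
  set b := Goedel.unaryB i (Goedel.headB i) with hb
  have h : machine.trans (midConfig α β i (decide (Goedel.diag i = α))).state
      (readInput x (2 * Goedel.diag i + 1)) (fun t =>
        (midConfig α β i (decide (Goedel.diag i = α))).tape t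
          ((midConfig α β i (decide (Goedel.diag i = α))).head t)) =
      compare (Goedel.phase i) (decide (Goedel.diag i = α)) (decide (Goedel.diag i = β)) a
        (a && decide (Goedel.headA i = α)) b (b && decide (Goedel.headB i = β)) := by
    rw [hβ]
    simp only [midConfig]
    cases Goedel.phase i <;> cases decide (Goedel.diag i = α) <;> rfl
  -- At an unmarked cell the copy of the input is still missing, but the head is then at the
  -- maximum, whose symbol has just been read.
  have hs : (if a then a && decide (Goedel.headA i = α) else decide (Goedel.diag i = α)) =
      decide (Goedel.headA i = α) := by
    rcases h0 : a with _ | _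
    · simp [Goedel.headA_eq_diag h0]
    · simp
  have ht : (if b then b && decide (Goedel.headB i = β) else decide (Goedel.diag i = β)) =
      decide (Goedel.headB i = β) := by
    rcases h0 : b with _ | _
    · simp [Goedel.headB_eq_diag h0]
    · simp
  have hadv : (!Goedel.phase i && a) = Goedel.advancesA i := rfl
  have hhit : (if Goedel.advancesA i then decide (Goedel.headA i = α) && decide (Goedel.diag i = β)
      else decide (Goedel.diag i = α) && decide (Goedel.headB i = β)) =
      decide (Goedel.unpair i = (α, β)) := by
    rw [Goedel.unpair_eq]
    split_ifs <;> simp [Prod.ext_iff]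
  rw [machine.step_of_trans_eq h]
  simp only [compare, hs, ht, hadv, hhit]
  rw [Config.mk.injEq]
  refine ⟨?_, ?_, funext fun t => ?_, funext fun t => ?_, rfl, rfl⟩
  · rw [Goedel.phase_add_one, ← hb]
    cases Goedel.advancesA i <;> cases b <;> simp
  · have hin : (midConfig α β i (decide (Goedel.diag i = α))).inputHead = 2 * Goedel.diag i + 1 := rfl
    change _ = 2 * Goedel.diag (i + 1)
    -- From an odd place, a left move returns to the even place of the same maximum and a right move
    -- reaches that of the next one.
    rw [Goedel.diag_add_one, ← hb]
    cases b
    · simp [Move.apply, hin, mul_add, add_assoc, one_add_one_eq_two]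
    · simp [hin, Move.left_apply_add_one]
  · have hA := Goedel.headA_add_one i
    have hB := Goedel.headB_add_one i
    rw [← hb] at hB
    rcases h1 : Goedel.advancesA i with _ | _ <;> rcases h2 : b with _ | _ <;>
      simp only [h1, h2, if_true, if_false, Bool.false_eq_true] at hA hB <;>
      fin_cases t <;> simp [config, midConfig, hA, hB, Move.apply]
  · have hA := Goedel.unaryA_add_one i
    have hB := Goedel.unaryB_add_one i
    fin_cases t
    · simp [config, midConfig, hA]
    · funext c
      rcases eq_or_ne c (Goedel.headA i) with rfl | hc <;> simp [config, midConfig, *]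
    · simp [config, midConfig, hB]
    · funext c
      rcases eq_or_ne c (Goedel.headB i) with rfl | hc <;> simp [config, midConfig, *]

theorem isBlockLimit (x : Cantor κ) (α β : Ordinal.{u}) {l : Ordinal.{u}}
    (hl : Order.IsSuccLimit l) : IsBlockLimit machine x 2 (config α β) l := by
  have H := Goedel.isScanLimit hl
  have hst : ∀ i, (config α β i).state = (config α β l).state ↔
      Goedel.phase i = Goedel.phase l := fun i => by
    simp only [config]
    cases Goedel.phase i <;> cases Goedel.phase l <;> simp
  have htape : ∀ i, ∀ j < 2, ((machine.step x)^[j] (config α β i)).tape = (config α β i).tape := by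
    intro i j hj
    interval_cases j
    · rfl
    · rw [Function.iterate_one, step_config]
      rfl
  have hout : ∀ i, ∀ j < 2, ((machine.step x)^[j] (config α β i)).outputTape = fun _ => false := by
    intro i j hj
    interval_cases j
    · rfl
    · rw [Function.iterate_one, step_config]
      rfl
  refine ⟨H.phase.mono fun i _ hi => ?_, fun i _ j h₁ h₂ => ?_, ?_, fun t => ?_, ?_, fun t p => ?_,
    fun p => .of_forall hl.bot_lt fun i _ j hj => ?_⟩
  · simp only [config]
    cases h1 : Goedel.phase i <;> cases h2 : Goedel.phase l <;> simp_all
  -- The states 2 to 5 of the intermediate step exceed the possible limit states 0 and 1.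
  · obtain rfl : j = 1 := by omega
    rw [Function.iterate_one, step_config]
    simp only [midConfig, config]
    cases Goedel.phase i <;> cases Goedel.phase l <;>
      cases readInput x (2 * Goedel.diag i) <;> decide
  · simp only [hst]
    exact H.two_mul_diag
  · simp only [hst]
    fin_cases t
    · exact H.headA
    · exact H.headA
    · exact H.headB
    · exact H.headB
  · simp only [hst]
    exact ⟨fun a ha => ⟨a + 1, hl.add_one_lt ha, fun i hi _ _ => Order.add_one_le_iff.1 hi⟩,
      H.headA.frequently.mono fun i hi hp => ⟨hp.1, hi.le⟩⟩
  · have key : EventuallyBelow l fun i => (config α β i).tape t p = (config α β l).tape t p := by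
      fin_cases t
      · exact H.unaryA p
      · exact (H.unaryA p).mono fun i _ hi => congrArg (· && decide (p = α)) hi
      · exact H.unaryB p
      · exact (H.unaryB p).mono fun i _ hi => congrArg (· && decide (p = β)) hi
    exact key.mono fun i _ hi j hj => by rw [htape i j hj]; exact hi
  · rw [hout i j hj]
    rfl

theorem config_zero (α β : Ordinal.{u}) : config α β 0 = machine.init := by
  rw [config, Machine.init, Config.mk.injEq]
  refine ⟨?_, ?_, funext fun t => ?_, funext fun t => ?_, rfl, rfl⟩
  · rw [Goedel.phase_zero]; rfl
  · simp [Goedel.diag_zero]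
  · fin_cases t <;> simp [Goedel.headA_zero, Goedel.headB_zero]
  · fin_cases t <;> simp [Goedel.unaryA_zero, Goedel.unaryB_zero]

/-- Up to the hit the maximum does not exceed `max α β`, so only the input below that bound matters.
By injectivity of `unpair` no earlier pair is a hit. -/
theorem run_eq {x : Cantor κ} {α β : Ordinal.{u}}
    (hα : ∀ m ≤ max α β, readInput x (2 * m) = decide (m = α))
    (hβ : ∀ m ≤ max α β, readInput x (2 * m + 1) = decide (m = β)) :
    machine.run x (2 * Goedel.pair α β + 2) =
      { config α β (Goedel.pair α β + 1) with
        state := 6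
        outputTape := Function.update (fun _ => false) (Goedel.pair α β) true } := by
  have hdiag : ∀ i ≤ Goedel.pair α β, Goedel.diag i ≤ max α β := by
    intro i hi
    have := Goedel.max_unpair_mono hi
    rwa [Goedel.unpair_pair (α, β)] at this
  have hstep : ∀ i ≤ Goedel.pair α β, (machine.step x)^[2] (config α β i) =
      { config α β (i + 1) with
        state := if Goedel.unpair i = (α, β) then 6 else if Goedel.phase (i + 1) then 1 else 0
        outputTape := Function.update (fun _ => false) i (decide (Goedel.unpair i = (α, β))) } := by
    intro i hi
    rw [Function.iterate_succ_apply, Function.iterate_one, step_config, hα _ (hdiag i hi),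
      step_midConfig (hβ _ (hdiag i hi))]
  have hrun := machine.run_eq_of_blocks (x := x) (τ := 0) (N := Goedel.pair α β) (k := 2) two_pos
    (C := config α β) (by rw [config_zero, Machine.run_zero]) ?_
    (fun l _ hl => isBlockLimit x α β hl) _ le_rfl
  · rw [zero_add, Nat.cast_ofNat] at hrun
    have h2 := machine.run_add_nat x (2 * Goedel.pair α β) 2
    rw [Nat.cast_ofNat] at h2
    rw [h2, hrun, hstep _ le_rfl, Goedel.unpair_pair (α, β)]
    simp
  · intro i hi
    have hne : Goedel.unpair i ≠ (α, β) := fun h => by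
      rw [← Goedel.unpair_pair (α, β)] at h
      exact hi.ne (Goedel.unpair_injective h)
    rw [hstep i hi.le]
    simp [hne, config]

theorem outputs (hκ : Cardinal.aleph0 ≤ κ) {x : Cantor κ} {α β : Iio κ.ord}
    (hα : KRep.evenPart hκ x = KRep.code α) (hβ : KRep.oddPart hκ x = KRep.code β) :
    machine.Outputs x (KRep.code (Goedel.pairEquiv hκ (α, β))) := by
  have hle : ∀ m ≤ max α.1 β.1, m < κ.ord := fun m hm => hm.trans_lt (max_lt α.2 β.2)
  have hrun := run_eq (x := x) (α := α) (β := β)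
    (fun m hm => by
      have := congrFun hα ⟨m, hle m hm⟩
      rw [KRep.evenPart] at this
      rw [readInput, dif_pos (Order.lt_add_one_iff.2 le_rfl |>.trans (KRep.two_mul_lt hκ (hle m hm))),
        this]
      simp [KRep.code, Subtype.ext_iff])
    (fun m hm => by
      have := congrFun hβ ⟨m, hle m hm⟩
      rw [KRep.oddPart] at this
      rw [readInput, dif_pos (KRep.two_mul_lt hκ (hle m hm)), this]
      simp [KRep.code, Subtype.ext_iff])
  have hp : Goedel.pair α β < κ.ord := Goedel.pair_lt_ord hκ α.2 β.2
  have hlim := Cardinal.isSuccLimit_ord hκ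
  have hτ : 2 * Goedel.pair (α : Ordinal.{u}) β + 2 < κ.ord := by
    have := hlim.add_one_lt (KRep.two_mul_lt hκ hp)
    rwa [add_assoc, one_add_one_eq_two] at this
  refine machine.outputs_of_isFinal hκ (d := (6 : Fin 7)) (fun _ _ => rfl) hτ ?_ ?_ ?_
  · rw [hrun]
  · rw [hrun]
    intro p hp
    have : Goedel.pair (α : Ordinal.{u}) β < p := Order.add_one_le_iff.1 hp
    simp [Function.update_of_ne this.ne']
  · rw [hrun]
    intro ξ
    simp [Function.update_apply, KRep.code, Goedel.pairEquiv, Subtype.ext_iff]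

end PairMachine

end KTM

/-! ### Even and odd places -/

theorem Ordinal.two_mul_ne_two_mul_add_one (a b : Ordinal.{u}) : 2 * a ≠ 2 * b + 1 := by
  intro h
  have := congrArg (· % 2) h
  simp [Ordinal.mul_add_mod_self, Ordinal.mod_eq_of_lt (one_lt_two : (1 : Ordinal.{u}) < 2)] at this

theorem Ordinal.lt_two_mul_add_one_iff {a c : Ordinal.{u}} :
    c < 2 * (a + 1) ↔ c < 2 * a ∨ c = 2 * a ∨ c = 2 * a + 1 := by
  rw [mul_add, mul_one, ← one_add_one_eq_two, ← add_assoc, one_add_one_eq_two,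
    Order.lt_add_one_iff, le_iff_lt_or_eq, Order.lt_add_one_iff, le_iff_lt_or_eq, or_assoc]

namespace KTM

theorem IsLiminfBelow.id {l : Ordinal.{u}} (hl : Order.IsSuccLimit l) {p : Ordinal.{u} → Prop}
    (hp : FrequentlyBelow l p) : IsLiminfBelow l p (fun i => i) l :=
  ⟨fun a ha => ⟨a + 1, hl.add_one_lt ha, fun _ hi _ _ => Order.add_one_le_iff.1 hi⟩,
    hp.mono fun _ hi h => ⟨h, hi.le⟩⟩

theorem IsLiminfBelow.two_mul {l : Ordinal.{u}} (hl : Order.IsSuccLimit l) {p : Ordinal.{u} → Prop}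
    (hp : FrequentlyBelow l p) : IsLiminfBelow l p (fun i => 2 * i) (2 * l) where
  eventually a ha := by
    obtain ⟨b, hb, hab⟩ := (Ordinal.lt_mul_iff_of_isSuccLimit hl).1 ha
    exact ⟨b, hb, fun i hi _ _ => hab.trans_le (mul_le_mul_right hi _)⟩
  frequently := hp.mono fun _ hi h => ⟨h, mul_le_mul_right hi.le _⟩

/-! ### A machine that computes the inverse of the Gödel pairing function -/

namespace UnpairMachine

/-- Mark the cell `0` on the tapes `2` and `5`. -/
def start : Action 6 7 :=
  ⟨1, .stay, ![false, false, true, false, false, true, false], fun _ => .stay, none⟩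

/-- In the phase `p`, proceed to the next pair if the input is `x = 0`. Otherwise mark the
positions of the heads. -/
def scan (p x : Bool) (r : Fin 7 → Bool) : Action 6 7 :=
  if x then
    ⟨3, .stay, ![r 0, !p && r 0, r 2, r 3, !(!p && r 0), r 5, !p && r 0], fun _ => .stay, none⟩
  else
    ⟨if !p && r 0 then 1 else if r 3 then 2 else 1, .right,
      ![true, r 1, r 2, true, r 4, r 5, r 6],
      if !p && r 0 then ![.right, .right, .right, .left, .left, .left, .stay]
      else if r 3 then ![.left, .left, .left, .right, .right, .right, .stay]
      else ![.left, .left, .left, .stay, .stay, .stay, .stay], none⟩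

/-- Move the heads back to the cell `0`. -/
def rewind (r : Fin 7 → Bool) : Action 6 7 :=
  if r 2 && r 5 then ⟨4, .stay, r, fun _ => .stay, none⟩
  else ⟨3, .stay, r, ![.left, .left, .left, .left, .left, .left, .stay], none⟩

/-- Write the output in an even place. -/
def emitFst (r : Fin 7 → Bool) : Action 6 7 :=
  ⟨5, .stay, r, fun _ => .stay, some (if r 6 then r 1 || r 4 else !r 3)⟩

/-- Write the output in an odd place. -/
def emitSnd (r : Fin 7 → Bool) : Action 6 7 :=
  ⟨if r 3 then 4 else 6, .stay, r, ![.right, .right, .right, .right, .right, .right, .stay],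
    some (if r 6 then !r 3 else r 1 || r 4)⟩

/-- Append a `0` to the output. -/
def final (r : Fin 7 → Bool) : Action 6 7 := ⟨6, .stay, r, fun _ => .stay, some false⟩

/-- The transition table. -/
def trans : Fin 7 → Bool → (Fin 7 → Bool) → Action 6 7 :=
  ![fun _ _ => start, scan false, scan true, fun _ => rewind, fun _ => emitFst, fun _ => emitSnd,
    fun _ => final]

/-- The machine. The heads on the scratch tapes `0`, `1` and `2` move like the head `A`, and those
on the tapes `3`, `4` and `5` like the head `B` of the enumeration of the pairs. -/
abbrev machine : Machine := ⟨6, 7, trans⟩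

/-- The tape with a `1` in cell `0` only. -/
noncomputable def zeroMark (c : Ordinal.{u}) : Bool := decide (c = 0)

/-- The configuration of the machine at time `1 + i`, while it searches for the pair. -/
noncomputable def config (i : Ordinal.{u}) : Config.{u} 6 7 where
  state := if Goedel.phase i then 2 else 1
  inputHead := i
  head := ![Goedel.headA i, Goedel.headA i, Goedel.headA i,
    Goedel.headB i, Goedel.headB i, Goedel.headB i, 0]
  tape := ![Goedel.unaryA i, fun _ => false, zeroMark,
    Goedel.unaryB i, fun _ => false, zeroMark, fun _ => false]
  outputHead := 0
  outputTape := fun _ => false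

/-- The contents of the scratch tapes after the pair with the number `γ` has been found. -/
noncomputable def markedTape (γ : Ordinal.{u}) : Fin 7 → Ordinal.{u} → Bool :=
  ![Goedel.unaryA γ, fun c => Goedel.advancesA γ && decide (c = Goedel.headA γ), zeroMark,
    Goedel.unaryB γ, fun c => !Goedel.advancesA γ && decide (c = Goedel.headB γ), zeroMark,
    fun c => Goedel.advancesA γ && decide (c = 0)]

/-- A configuration in which the heads move back to the cell `0`. -/
noncomputable def rewindConfig (γ a b : Ordinal.{u}) : Config.{u} 6 7 where
  state := 3
  inputHead := γ
  head := ![a, a, a, b, b, b, 0]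
  tape := markedTape γ
  outputHead := 0
  outputTape := fun _ => false

/-- The name of the pair with the number `γ`. -/
noncomputable def target (γ c : Ordinal.{u}) : Bool :=
  decide (c = 2 * (Goedel.unpair γ).1) || decide (c = 2 * (Goedel.unpair γ).2 + 1)

/-- The configuration of the machine after it has written the output in the places before
`2 * ξ`. -/
noncomputable def emitConfig (γ ξ : Ordinal.{u}) : Config.{u} 6 7 where
  state := 4
  inputHead := γ
  head := ![ξ, ξ, ξ, ξ, ξ, ξ, 0]
  tape := markedTape γ
  outputHead := 2 * ξ
  outputTape := fun c => decide (c < 2 * ξ) && target γ c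

variable {κ : Cardinal.{u}}

/-- One initial step lays down the marks in cell 0 that later stop the rewinding, so stage `i` of
the search is time `1 + i`. -/
theorem step_init (x : Cantor κ) : machine.step x machine.init = config 0 := by
  rw [machine.step_of_trans_eq (a := start) rfl, config, Config.mk.injEq]
  refine ⟨?_, rfl, funext fun t => ?_, funext fun t => ?_, rfl, rfl⟩
  · rw [Goedel.phase_zero]; rfl
  · fin_cases t <;> simp [start, Goedel.headA_zero, Goedel.headB_zero, Move.apply, Machine.init]
  · fin_cases t <;> funext c <;> rcases eq_or_ne c 0 with rfl | hc <;>
      simp [start, Goedel.unaryA_zero, Goedel.unaryB_zero, Machine.init, zeroMark, *]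

theorem trans_config (i : Ordinal.{u}) (b : Bool) :
    machine.trans (config i).state b (fun t => (config i).tape t ((config i).head t)) =
      scan (Goedel.phase i) b (fun t => (config i).tape t ((config i).head t)) := by
  have h : machine.trans (config i).state = scan (Goedel.phase i) := by
    simp only [config]
    cases Goedel.phase i <;> rfl
  rw [h]

theorem step_config_of_false {x : Cantor κ} {i : Ordinal.{u}} (hx : readInput x i = false) :
    machine.step x (config i) = config (i + 1) := by
  have h := trans_config i (readInput x i)
  rw [hx] at h
  rw [machine.step_of_trans_eq ((congrArg (fun b => machine.trans (config i).state b _) hx).trans h)]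
  set b := Goedel.unaryB i (Goedel.headB i) with hb
  have hadv : (!Goedel.phase i && (config i).tape 0 ((config i).head 0)) = Goedel.advancesA i := rfl
  have h3 : (config i).tape 3 ((config i).head 3) = b := rfl
  have hA := Goedel.headA_add_one i
  have hB := Goedel.headB_add_one i
  have hph := Goedel.phase_add_one i
  have hUA := Goedel.unaryA_add_one i
  have hUB := Goedel.unaryB_add_one i
  rw [← hb] at hB hph
  simp only [scan, Bool.false_eq_true, if_false, hadv, h3]
  rw [config, Config.mk.injEq]
  refine ⟨?_, rfl, funext fun t => ?_, funext fun t => ?_, rfl, rfl⟩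
  · change _ = if Goedel.phase (i + 1) then 2 else 1
    rw [hph]
    cases Goedel.advancesA i <;> cases b <;> simp
  · rcases h1 : Goedel.advancesA i with _ | _ <;> rcases h2 : b with _ | _ <;>
      simp only [h1, h2, if_true, if_false, Bool.false_eq_true] at hA hB <;>
      fin_cases t <;> simp [config, hA, hB, Move.apply]
  · fin_cases t <;> simp [config, hUA, hUB]

theorem step_config_of_true {x : Cantor κ} {i : Ordinal.{u}} (hx : readInput x i = true) :
    machine.step x (config i) = rewindConfig i (Goedel.headA i) (Goedel.headB i) := by
  have h := trans_config i (readInput x i)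
  rw [hx] at h
  rw [machine.step_of_trans_eq ((congrArg (fun b => machine.trans (config i).state b _) hx).trans h)]
  have hadv : (!Goedel.phase i && (config i).tape 0 ((config i).head 0)) = Goedel.advancesA i := rfl
  simp only [scan, if_true, hadv]
  rw [rewindConfig, Config.mk.injEq]
  refine ⟨rfl, rfl, funext fun t => ?_, funext fun t => ?_, rfl, rfl⟩
  · fin_cases t <;> rfl
  · fin_cases t
    · simp [config, markedTape]
    · funext c
      simp [config, markedTape, Function.update_apply]
      grind
    · simp [config, markedTape]
    · simp [config, markedTape]
    · funext c
      simp [config, markedTape, Function.update_apply]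
      grind
    · simp [config, markedTape]
    · funext c
      simp [config, markedTape, Function.update_apply]
      grind

theorem isBlockLimit_config (x : Cantor κ) {l : Ordinal.{u}} (hl : Order.IsSuccLimit l) :
    IsBlockLimit machine x 1 config l := by
  have H := Goedel.isScanLimit hl
  have hst : ∀ i : Ordinal.{u}, (config i).state = (config l).state ↔
      Goedel.phase i = Goedel.phase l := fun i => by
    simp only [config]
    cases Goedel.phase i <;> cases Goedel.phase l <;> simp
  have hfr : FrequentlyBelow l fun i => Goedel.phase i = Goedel.phase l :=
    H.headA.frequently.mono fun i _ hi => hi.1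
  refine ⟨H.phase.mono fun i _ hi => ?_, fun i _ j h₁ h₂ => by omega, ?_, fun t => ?_, ?_,
    fun t p => ?_, fun p => .of_forall hl.bot_lt fun i _ j hj => ?_⟩
  · simp only [config]
    cases h1 : Goedel.phase i <;> cases h2 : Goedel.phase l <;> simp_all
  · simp only [hst]
    exact .id hl hfr
  · simp only [hst]
    fin_cases t
    · exact H.headA
    · exact H.headA
    · exact H.headA
    · exact H.headB
    · exact H.headB
    · exact H.headB
    · exact .const hl.bot_lt hfr 0
  · simp only [hst]
    exact .const hl.bot_lt hfr 0
  · have key : EventuallyBelow l fun i => (config i).tape t p = (config l).tape t p := by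
      have hconst : ∀ b : Bool, EventuallyBelow l fun _ => b = b :=
        fun _ => .of_forall hl.bot_lt fun _ _ => rfl
      fin_cases t
      · exact H.unaryA p
      · exact hconst _
      · exact hconst _
      · exact H.unaryB p
      · exact hconst _
      · exact hconst _
      · exact hconst _
    refine key.mono fun i _ hi j hj => ?_
    obtain rfl : j = 0 := by omega
    exact hi
  · obtain rfl : j = 0 := by omega
    rfl

theorem step_rewindConfig_zero (x : Cantor κ) (γ : Ordinal.{u}) :
    machine.step x (rewindConfig γ 0 0) = emitConfig γ 0 := by
  rw [machine.step_of_trans_eq (a := rewind fun t =>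
    (rewindConfig γ 0 0).tape t ((rewindConfig γ 0 0).head t)) rfl]
  have h : ((rewindConfig γ 0 0).tape 2 ((rewindConfig γ 0 0).head 2) &&
      (rewindConfig γ 0 0).tape 5 ((rewindConfig γ 0 0).head 5)) = true := by
    simp [rewindConfig, markedTape, zeroMark]
  simp only [rewind, h, if_true, Function.update_eq_self]
  rw [emitConfig, Config.mk.injEq]
  refine ⟨rfl, rfl, funext fun t => ?_, rfl, ?_, ?_⟩
  · fin_cases t <;> rfl
  · simp [rewindConfig]
  · simp [rewindConfig]

theorem step_rewindConfig (x : Cantor κ) {γ a b : Ordinal.{u}} (h : a ≠ 0 ∨ b ≠ 0) :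
    machine.step x (rewindConfig γ a b) =
      rewindConfig γ (Move.left.apply a) (Move.left.apply b) := by
  rw [machine.step_of_trans_eq (a := rewind fun t =>
    (rewindConfig γ a b).tape t ((rewindConfig γ a b).head t)) rfl]
  have h : ((rewindConfig γ a b).tape 2 ((rewindConfig γ a b).head 2) &&
      (rewindConfig γ a b).tape 5 ((rewindConfig γ a b).head 5)) = false := by
    simp [rewindConfig, markedTape, zeroMark]
    tauto
  simp only [rewind, h, Bool.false_eq_true, if_false, Function.update_eq_self]
  rw [rewindConfig, rewindConfig, Config.mk.injEq]
  refine ⟨rfl, rfl, funext fun t => ?_, rfl, rfl, rfl⟩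
  fin_cases t <;> rfl

/-- Nested well-founded induction: a left move strictly lowers a nonzero position, and a head that
arrives first waits at 0. -/
theorem exists_iterate_rewindConfig (x : Cantor κ) (γ a b : Ordinal.{u}) :
    ∃ n, (machine.step x)^[n] (rewindConfig γ a b) = emitConfig γ 0 := by
  induction a using WellFoundedLT.induction generalizing b with
  | _ a iha =>
    induction b using WellFoundedLT.induction with
    | _ b ihb =>
      rcases eq_or_ne a 0 with rfl | ha
      · rcases eq_or_ne b 0 with rfl | hb
        · exact ⟨1, step_rewindConfig_zero x γ⟩
        · obtain ⟨n, hn⟩ := ihb _ (Move.left_apply_lt hb)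
          refine ⟨n + 1, ?_⟩
          rw [Function.iterate_succ_apply, step_rewindConfig x (.inr hb), Move.left_apply_zero, hn]
      · obtain ⟨n, hn⟩ := iha _ (Move.left_apply_lt ha) (Move.left.apply b)
        exact ⟨n + 1, by rw [Function.iterate_succ_apply, step_rewindConfig x (.inl ha), hn]⟩

/-- The configuration of the machine in the middle of the output for cell `ξ`. -/
noncomputable def midEmitConfig (γ ξ : Ordinal.{u}) : Config.{u} 6 7 :=
  { emitConfig γ ξ with
    state := 5
    outputHead := 2 * ξ + 1
    outputTape := Function.update (emitConfig γ ξ).outputTape (2 * ξ)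
      (decide (ξ = (Goedel.unpair γ).1)) }

/-- Tape 6 tells which component is the maximum. That component is the first unmarked cell of tape
3; the other is the single mark on tape 1 or 4, one of which is empty. Beyond the maximum tape 3 is
blank throughout, hence the bound on `ξ`. -/
theorem symbols_markedTape {γ ξ : Ordinal.{u}} (hξ : ξ ≤ Goedel.diag γ) :
    (if markedTape γ 6 0 then markedTape γ 1 ξ || markedTape γ 4 ξ else !markedTape γ 3 ξ) =
      decide (ξ = (Goedel.unpair γ).1) ∧
    (if markedTape γ 6 0 then !markedTape γ 3 ξ else markedTape γ 1 ξ || markedTape γ 4 ξ) =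
      decide (ξ = (Goedel.unpair γ).2) := by
  have h1 : markedTape γ 1 ξ = (Goedel.advancesA γ && decide (ξ = Goedel.headA γ)) := rfl
  have h3 : markedTape γ 3 ξ = decide (ξ < Goedel.diag γ) := by
    simp [markedTape, Goedel.unaryB]
  have h4 : markedTape γ 4 ξ = (!Goedel.advancesA γ && decide (ξ = Goedel.headB γ)) := rfl
  have h6 : markedTape γ 6 0 = Goedel.advancesA γ := by simp [markedTape]
  have hd : (!decide (ξ < Goedel.diag γ)) = decide (ξ = Goedel.diag γ) := by
    rw [Bool.eq_iff_iff]
    simp only [Bool.not_eq_true', decide_eq_false_iff_not, decide_eq_true_eq]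
    exact ⟨fun h => le_antisymm hξ (not_lt.1 h), fun h => h.not_lt⟩
  rw [h1, h3, h4, h6, hd, Goedel.unpair_eq]
  cases Goedel.advancesA γ <;> simp

theorem step_emitConfig (x : Cantor κ) {γ ξ : Ordinal.{u}} (hξ : ξ ≤ Goedel.diag γ) :
    machine.step x (emitConfig γ ξ) = midEmitConfig γ ξ := by
  rw [machine.step_of_trans_eq (a := emitFst fun t =>
    (emitConfig γ ξ).tape t ((emitConfig γ ξ).head t)) rfl]
  have h : (if (emitConfig γ ξ).tape 6 ((emitConfig γ ξ).head 6) then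
      (emitConfig γ ξ).tape 1 ((emitConfig γ ξ).head 1) ||
        (emitConfig γ ξ).tape 4 ((emitConfig γ ξ).head 4)
      else !(emitConfig γ ξ).tape 3 ((emitConfig γ ξ).head 3)) =
      decide (ξ = (Goedel.unpair γ).1) := (symbols_markedTape hξ).1
  simp only [emitFst, h, Function.update_eq_self]
  rfl

theorem step_midEmitConfig (x : Cantor κ) {γ ξ : Ordinal.{u}} (hξ : ξ ≤ Goedel.diag γ) :
    machine.step x (midEmitConfig γ ξ) =
      { emitConfig γ (ξ + 1) with state := if ξ < Goedel.diag γ then 4 else 6 } := by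
  rw [machine.step_of_trans_eq (a := emitSnd fun t =>
    (midEmitConfig γ ξ).tape t ((midEmitConfig γ ξ).head t)) rfl]
  have h : (if (midEmitConfig γ ξ).tape 6 ((midEmitConfig γ ξ).head 6) then
      !(midEmitConfig γ ξ).tape 3 ((midEmitConfig γ ξ).head 3)
      else (midEmitConfig γ ξ).tape 1 ((midEmitConfig γ ξ).head 1) ||
        (midEmitConfig γ ξ).tape 4 ((midEmitConfig γ ξ).head 4)) =
      decide (ξ = (Goedel.unpair γ).2) := (symbols_markedTape hξ).2
  have h3 : (midEmitConfig γ ξ).tape 3 ((midEmitConfig γ ξ).head 3) =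
      decide (ξ < Goedel.diag γ) := by
    simp [midEmitConfig, emitConfig, markedTape, Goedel.unaryB]
  simp only [emitSnd, h]
  simp only [h3, Function.update_eq_self, decide_eq_true_eq]
  rw [Config.mk.injEq]
  refine ⟨rfl, rfl, funext fun t => ?_, rfl, ?_, ?_⟩
  · fin_cases t <;> rfl
  · simp [midEmitConfig, emitConfig, mul_add, add_assoc, one_add_one_eq_two]
  · funext c
    simp only [midEmitConfig, emitConfig, target, Function.update_apply]
    rcases eq_or_ne c (2 * ξ + 1) with rfl | hc1
    · simp [Ordinal.lt_two_mul_add_one_iff, (Ordinal.two_mul_ne_two_mul_add_one _ _).symm]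
    · rcases eq_or_ne c (2 * ξ) with rfl | hc0
      · simp [Ordinal.two_mul_ne_two_mul_add_one]
      · simp [hc0, hc1, Ordinal.lt_two_mul_add_one_iff]

theorem isBlockLimit_emitConfig (x : Cantor κ) {γ l : Ordinal.{u}} (hl : Order.IsSuccLimit l)
    (hle : l ≤ Goedel.diag γ) : IsBlockLimit machine x 2 (emitConfig γ) l := by
  have hfr : FrequentlyBelow l fun i => (emitConfig γ i).state = (emitConfig γ l).state :=
    .of_forall fun _ _ => rfl
  have hmid : ∀ i < l, machine.step x (emitConfig γ i) = midEmitConfig γ i :=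
    fun i hi => step_emitConfig x (hi.le.trans hle)
  refine ⟨.of_forall hl.bot_lt fun _ _ => le_rfl, fun i hi j h₁ h₂ => ?_,
    .const hl.bot_lt hfr γ, fun t => ?_, .two_mul hl hfr,
    fun t p => .of_forall hl.bot_lt fun i hi j hj => ?_, fun p => ?_⟩
  · obtain rfl : j = 1 := by omega
    rw [Function.iterate_one, hmid i hi]
    simp only [midEmitConfig, emitConfig]
    decide
  · fin_cases t
    · exact .id hl hfr
    · exact .id hl hfr
    · exact .id hl hfr
    · exact .id hl hfr
    · exact .id hl hfr
    · exact .id hl hfr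
    · exact .const hl.bot_lt hfr 0
  · interval_cases j
    · rfl
    · rw [Function.iterate_one, hmid i hi]
      rfl
  · have key : EventuallyBelow l fun i => p ≠ 2 * i ∧ (p < 2 * i ↔ p < 2 * l) := by
      rcases lt_or_ge p (2 * l) with hp | hp
      · obtain ⟨b, hb, hpb⟩ := (Ordinal.lt_mul_iff_of_isSuccLimit hl).1 hp
        refine ⟨b, hb, fun i hi _ => ?_⟩
        have := hpb.trans_le (mul_le_mul_right hi _)
        exact ⟨this.ne, by simp [this, hp]⟩
      · refine .of_forall hl.bot_lt fun i hi => ?_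
        have : 2 * i < p :=
          (lt_of_lt_of_le ((mul_lt_mul_iff_right₀ two_pos).2 hi) hp)
        exact ⟨this.ne', iff_of_false this.not_gt hp.not_gt⟩
    refine key.and (.of_forall hl.bot_lt fun i hi => hi) |>.mono fun i _ ⟨⟨h₁, h₂⟩, hi⟩ j hj => ?_
    interval_cases j
    · change (decide _ && _) = (decide _ && _)
      simp only [h₂]
    · rw [Function.iterate_one, hmid i hi]
      simp [midEmitConfig, emitConfig, h₁, h₂]

theorem target_eq_false {γ c : Ordinal.{u}} (h : 2 * (Goedel.diag γ + 1) ≤ c) :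
    target γ c = false := by
  have key : ∀ a ≤ Goedel.diag γ, 2 * a < c ∧ 2 * a + 1 < c := fun a ha => by
    have : 2 * (a + 1) ≤ c := (mul_le_mul_right (by gcongr) _).trans h
    exact ⟨(Ordinal.lt_two_mul_add_one_iff.2 (.inr (.inl rfl))).trans_le this,
      (Ordinal.lt_two_mul_add_one_iff.2 (.inr (.inr rfl))).trans_le this⟩
  simp [target, (key _ (le_max_left _ _)).1.ne', (key _ (le_max_right _ _)).2.ne']

/-- The times add up: 1 + γ for the search, finitely many steps to mark and rewind, and two for each
cell up to and including the maximum. The sum stays below κ because κ is closed under ordinal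
addition and multiplication. -/
theorem exists_run_eq (hκ : Cardinal.aleph0 ≤ κ) {x : Cantor κ} {γ : Ordinal.{u}} (hγ : γ < κ.ord)
    (hx : ∀ i ≤ γ, readInput x i = decide (i = γ)) :
    ∃ τ < κ.ord, machine.run x τ =
      { emitConfig γ (Goedel.diag γ + 1) with state := 6, outputTape := target γ } := by
  have hlim := Cardinal.isSuccLimit_ord hκ
  have hscan : machine.run x (1 + γ) = config γ := by
    have := machine.run_eq_of_blocks (x := x) (τ := 1) (N := γ) (k := 1) one_pos (C := config) ?_
      (fun i hi => ?_) (fun l _ hl => isBlockLimit_config x hl) γ le_rfl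
    · simpa using this
    · rw [← zero_add 1, Machine.run_add_one, Machine.run_zero, step_init]
    · exact step_config_of_false (by simp [hx i hi.le, hi.ne])
  obtain ⟨n, hn⟩ := exists_iterate_rewindConfig x γ (Goedel.headA γ) (Goedel.headB γ)
  have hemit : machine.run x (1 + γ + (n + 1 : ℕ)) = emitConfig γ 0 := by
    rw [Machine.run_add_nat, hscan, Function.iterate_succ_apply,
      step_config_of_true (by simp [hx γ le_rfl]), hn]
  have hrun := machine.run_eq_of_blocks (k := 2) two_pos hemit (N := Goedel.diag γ)
    (fun i hi => ?_) (fun l hle hl => isBlockLimit_emitConfig x hl hle) _ le_rfl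
  · refine ⟨1 + γ + (n + 1 : ℕ) + (2 : ℕ) * Goedel.diag γ + (2 : ℕ), ?_, ?_⟩
    · have hdiag : Goedel.diag γ < κ.ord := (Goedel.max_unpair_le γ).trans_lt hγ
      have hnat : ∀ m : ℕ, (m : Ordinal.{u}) < κ.ord := fun m =>
        (Ordinal.natCast_lt_omega0 m).trans_le (Cardinal.omega0_le_ord.2 hκ)
      have hadd := fun {a b : Ordinal.{u}} (ha : a < κ.ord) (hb : b < κ.ord) =>
        Ordinal.isPrincipal_add_ord hκ ha hb
      refine hadd (hadd (hadd (hadd ?_ hγ) (hnat _)) ?_) (hnat _)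
      · exact_mod_cast hnat 1
      · exact Ordinal.isPrincipal_mul_ord hκ (hnat _) hdiag
    · rw [Machine.run_add_nat, hrun, Function.iterate_succ_apply, Function.iterate_one,
        step_emitConfig x le_rfl, step_midEmitConfig x le_rfl, Config.mk.injEq]
      refine ⟨by simp, rfl, rfl, rfl, rfl, funext fun c => ?_⟩
      rcases lt_or_ge c (2 * (Goedel.diag γ + 1)) with hc | hc
      · simp [emitConfig, hc]
      · simp [emitConfig, target_eq_false hc]
  · rw [Function.iterate_succ_apply, Function.iterate_one, step_emitConfig x hi.le,
      step_midEmitConfig x hi.le, if_pos hi]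
    rfl

theorem outputs (hκ : Cardinal.aleph0 ≤ κ) (γ : Iio κ.ord) :
    machine.Outputs (KRep.code γ) fun ξ => target γ ξ := by
  obtain ⟨τ, hτ, hrun⟩ := exists_run_eq hκ (x := KRep.code γ) γ.2 fun i hi => by
    rw [readInput, dif_pos (hi.trans_lt γ.2)]
    simp [KRep.code, Subtype.ext_iff]
  refine machine.outputs_of_isFinal hκ (d := (6 : Fin 7)) (fun _ _ => rfl) hτ ?_ ?_ ?_
  · rw [hrun]
  · rw [hrun]
    exact fun p hp => target_eq_false hp
  · rw [hrun]
    exact fun ξ => rfl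

theorem evenPart_target (hκ : Cardinal.aleph0 ≤ κ) (γ : Iio κ.ord) :
    KRep.evenPart hκ (fun ξ => target γ ξ) = KRep.code ((Goedel.pairEquiv hκ).symm γ).1 := by
  funext ξ
  simp [KRep.evenPart, target, KRep.code, Goedel.pairEquiv,
    Ordinal.two_mul_ne_two_mul_add_one, Subtype.ext_iff]

theorem oddPart_target (hκ : Cardinal.aleph0 ≤ κ) (γ : Iio κ.ord) :
    KRep.oddPart hκ (fun ξ => target γ ξ) = KRep.code ((Goedel.pairEquiv hκ).symm γ).2 := by
  funext ξ
  simp [KRep.oddPart, target, KRep.code, Goedel.pairEquiv,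
    (Ordinal.two_mul_ne_two_mul_add_one _ _).symm, Subtype.ext_iff]

end UnpairMachine

end KTM

/-! ### Names of ordinals and of pairs, and the conclusion -/

namespace KRep

variable {κ : Cardinal.{u}}

theorem mem_ord {p : Cantor κ} {α : Iio κ.ord} : α ∈ (ord κ).toPFun p ↔ p = code α := by
  constructor
  · rintro ⟨h, rfl⟩
    exact h.choose_spec
  · rintro rfl
    have h : ∃ β, code α = code β := ⟨α, rfl⟩
    exact ⟨h, (code_injective h.choose_spec).symm⟩

theorem mem_prod_ord (hκ : Cardinal.aleph0 ≤ κ) {r : Cantor κ} {p : Iio κ.ord × Iio κ.ord} :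
    p ∈ (prod hκ (ord κ) (ord κ)).toPFun r ↔
      evenPart hκ r = code p.1 ∧ oddPart hκ r = code p.2 := by
  rw [← mem_ord, ← mem_ord]
  obtain ⟨α, β⟩ := p
  simp [prod]

end KRep

theorem lemma1 (κ : Cardinal.{u}) (hκ : Cardinal.aleph0 < κ) (hpow : κ ^< κ = κ) :
    ∃ g : (Iio κ.ord × Iio κ.ord) ≃ Iio κ.ord,
      (∀ α β : Iio κ.ord, (g (α, β) : Ordinal.{u}) = Goedel.pair α β) ∧
      KRep.IsComputable
        (KRep.prod hκ.le (KRep.ord κ) (KRep.ord κ))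
        (KRep.ord κ) g ∧
      KRep.IsComputable (KRep.ord κ)
        (KRep.prod hκ.le (KRep.ord κ) (KRep.ord κ)) g.symm := by
  refine ⟨Goedel.pairEquiv hκ.le, fun _ _ => rfl,
    KRep.isComputable_of_outputs KTM.PairMachine.machine fun r p hp => ?_,
    KRep.isComputable_of_outputs KTM.UnpairMachine.machine fun q γ hq => ?_⟩
  · rw [KRep.mem_prod_ord] at hp
    exact ⟨_, KRep.mem_ord.2 rfl, KTM.PairMachine.outputs hκ.le hp.1 hp.2⟩
  · rw [KRep.mem_ord] at hq
    subst hq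
    exact ⟨_, (KRep.mem_prod_ord hκ.le).2 ⟨KTM.UnpairMachine.evenPart_target hκ.le γ,
      KTM.UnpairMachine.oddPart_target hκ.le γ⟩, KTM.UnpairMachine.outputs hκ.le γ⟩
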